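/- **Syntax.** Fix a set $\mathsf{Prop}$ of propositional symbols. Classical formulas (formulas of $\mathcal{ML}$) are given by $\alpha ::= p\mid\bot\mid\neg\alpha\mid\alpha\lor\alpha\mid\alpha\land\alpha\mid\Diamond\alpha\mid\Box\alpha$ with $p\in\mathsf{Prop}$; put $\top:=\neg\bot$. Below $\alpha,\beta$ (with indices) denote classical formulas. We consider three logics. * $\mathcal{ML}(\subseteq)$: $\phi::=p\mid\bot\mid(\alpha_1\dots\alpha_n\subseteq\beta_1\dots\beta_n)\mid\neg\alpha\mid\phi\lor\phi\mid\phi\land\phi\mid\Diamond\phi\mid\Box\phi$, with $n\ge 1$. * $\mathcal{ML}(\bullet)$ for $\bullet\in\{\triangledown,\boldsymbol{\cdot}\!\Diamond\}$ (the might and the singular might operator): $\phi::=p\mid\bot\mid\neg\alpha\mid\phi\lor\phi\mid\phi\land\phi\mid\Diamond\phi\mid\Box\phi\mid\bullet\phi$. $\mathsf{Prop}(\phi)$ is the set of propositional symbols occurring in $\phi$. The modal depth $md(\phi)$ is $0$ for $p$ and $\bot$; $md(\neg\alpha)=md(\alpha)$; it is the maximum over the components for $\lor$, $\land$ and inclusion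 atoms; $md(\Diamond\phi)=md(\Box\phi)=md(\phi)+1$; $md(\bullet\phi)=md(\phi)$. Empty conjunctions are $\top$ and empty disjunctions are $\bot$. For $x\in\{\top,\bot\}$ put $\alpha^\top:=\alpha$, $\alpha^\bot:=\neg\alpha$; for $\mathsf a=\alpha_1\dots\alpha_n$ and $\mathsf x=x_1\dots x_n\in\{\top,\bot\}^n$ put $\mathsf a^{\mathsf x}:=\alpha_1^{x_1}\land\dots\land\alpha_n^{x_n}$. **Derivations.** $\Gamma\vdash\phi$ means that $\phi$ has a natural deduction derivation, with the rules of the logic in question, whose undischarged assumptions are in $\Gamma$; $\phi\dashv\vdash\psi$ means $\{\phi\}\vdash\psi$ and $\{\psi\}\vdash\phi$. Square brackets mark assumptions that the rule discharges. *Rules of all three systems.* ($\neg$I) from a derivation of $\bot$ from $[\alpha]$, infer $\neg\alpha$; (RAA) from a derivation of $\bot$ from $[\neg\alpha]$, infer $\alpha$; ($\neg$E) $\alpha,\neg\alpha\,/\,\phi$; ($\lor$I) $\phi\,/\,\phi\lor\psi$ and $\psi\,/\,\phi\lor\psi$; ($\lor$E) from $\phi\lor\psi$ and derivations of $\chi$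 from $[\phi]$ and of $\chi$ from $[\psi]$, infer $\chi$; ($\land$I) $\phi,\psi\,/\,\phi\land\psi$; ($\land$E) $\phi\land\psi\,/\,\phi$ and $\phi\land\psi\,/\,\psi$; $\neg\Box\alpha\,/\,\Diamond\neg\alpha$; $\Diamond\neg\alpha\,/\,\neg\Box\alpha$; $\Diamond(\phi\lor\psi)\,/\,\Diamond\phi\lor\Diamond\psi$; ($\Box$Mon) from $\Box\phi_1,\dots,\Box\phi_n$ ($n\ge0$) and a derivation of $\psi$ from $[\phi_1],\dots,[\phi_n]$, infer $\Box\psi$; ($\Diamond$Mon) from $\Diamond\phi$ and a derivation of $\psi$ from $[\phi]$, infer $\Diamond\psi$. In $\neg$I, RAA and $\lor$E all other undischarged assumptions of the subderivations with discharged assumptions must be classical; in $\Box$Mon and $\Diamond$Mon there must be no others. *Further rules of $\mathcal{ML}(\subseteq)$* ($n\ge0$ in the rules with $n$ further premises): $/\,\mathsf a\subseteq\mathsf a$; $\ \alpha^x,\ \mathsf b\subseteq\mathsf c\,/\,x\mathsf b\subseteq\alpha\mathsf c$; $\ \neg\mathsf a^{\mathsf x},\ \mathsf x\subseteq\mathsf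 a\,/\,\phi$; from $(\mathsf x\subseteq\mathsf a)\lor\psi$ and derivations of $\chi$ from $[\mathsf x\subseteq\mathsf a]$ and from $[\psi]$, infer $\chi$; $\ \bigwedge_{\mathsf x\in\{\top,\bot\}^{|\mathsf a|}}(\neg\mathsf a^{\mathsf x}\lor\mathsf x\subseteq\mathsf b)\,/\,\mathsf a\subseteq\mathsf b$; $\ \mathsf a\subseteq\mathsf b\,/\,\neg\mathsf a^{\mathsf x}\lor\mathsf x\subseteq\mathsf b$; $\ \phi\lor\psi,\ \mathsf x_1\subseteq\mathsf a_1,\dots,\mathsf x_n\subseteq\mathsf a_n\,/\,((\phi\lor\mathsf a_1^{\mathsf x_1}\lor\dots\lor\mathsf a_n^{\mathsf x_n})\land\mathsf x_1\subseteq\mathsf a_1\land\dots\land\mathsf x_n\subseteq\mathsf a_n)\lor\psi$; $\ \Diamond(\mathsf x\subseteq\mathsf a)\,/\,\top\subseteq\Diamond\mathsf a^{\mathsf x}$; $\ \top\subseteq\Diamond\mathsf a^{\mathsf x}\,/\,\Box(\mathsf x\subseteq\mathsf a)$; $\ \top\subseteq\Diamond\beta,\ \Box(\mathsf x\subseteq\mathsf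 a)\,/\,\top\subseteq\Diamond\mathsf a^{\mathsf x}$; from $\Box((\mathsf x\subseteq\mathsf a)\lor\psi)$ and derivations of $\chi$ from $[\top\subseteq\Diamond\mathsf a^{\mathsf x}]$ and from $[\Box\psi]$, infer $\chi$; $\ \Diamond\phi,\ x_1\subseteq\Diamond\alpha_1,\dots,x_n\subseteq\Diamond\alpha_n\,/\,\Diamond((\phi\lor\alpha_1^{x_1}\lor\dots\lor\alpha_n^{x_n})\land x_1\subseteq\alpha_1\land\dots\land x_n\subseteq\alpha_n)$. *Further rules of $\mathcal{ML}(\bullet)$* ($n\ge0$ as above): for $\bullet=\triangledown$ only: $\triangledown\phi,\triangledown\psi\,/\,\triangledown((\phi\lor\psi)\land\triangledown\phi\land\triangledown\psi)$ and $\triangledown\triangledown\phi\,/\,\triangledown\phi$; for $\bullet=\boldsymbol{\cdot}\!\Diamond$ only: $\bullet(\bullet\phi\land\psi)\,/\,\bullet(\phi\land\psi)$; for both: from $\bullet\phi$ and a derivation of $\psi$ from $[\phi]$ whose other undischarged assumptions are classical, infer $\bullet\psi$; $\ \bullet(\phi\lor\psi)\,/\,\bullet\phi\lor\bullet\psi$;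 $\ \alpha\,/\,\bullet\alpha$; $\ \neg\alpha,\bullet\alpha\,/\,\phi$; from $\bullet\phi\lor\psi$ and derivations of $\chi$ from $[\bullet\phi]$ and from $[\psi]$, infer $\chi$; $\ \phi\lor\psi,\bullet\chi_1,\dots,\bullet\chi_n\,/\,((\phi\lor\chi_1\lor\dots\lor\chi_n)\land\bullet\chi_1\land\dots\land\bullet\chi_n)\lor\psi$; $\ \bullet\Diamond\psi,\Box\bullet\phi\,/\,\bullet\Diamond\phi$; (i) $\bullet\Diamond\phi\,/\,\Box\bullet\phi$; from $\Box(\bullet\phi\lor\psi)$ and derivations of $\chi$ from $[\bullet\Diamond\phi]$ and from $[\Box\psi]$, infer $\chi$; $\ \Diamond\bullet\phi\,/\,\bullet\Diamond\phi$; (ii) $\Diamond\phi,\bullet\Diamond\psi_1,\dots,\bullet\Diamond\psi_n\,/\,\Diamond((\phi\lor\psi_1\lor\dots\lor\psi_n)\land\bullet\psi_1\land\dots\land\bullet\psi_n)$. **Hintikka formulas.** Let $\mathsf X\subseteq\mathsf{Prop}$ be finite. A model $M=(W,R,V)$ over $\mathsf X$ consists of a set $W$, a relation $R\subseteq W\times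 W$ and a map $V:\mathsf X\to\mathcal P(W)$; a team of $M$ is a subset $T\subseteq W$. For $w\in W$ let $\chi^{0}_{M,w}:=\bigwedge\{p\in\mathsf X\mid w\in V(p)\}\land\bigwedge\{\neg p\mid p\in\mathsf X,\ w\notin V(p)\}$ and $$\chi^{k+1}_{M,w}:=\chi^k_{M,w}\land\bigwedge_{v\in R[w]}\Diamond\chi^k_{M,v}\land\Box\bigvee_{v\in R[w]}\chi^k_{M,v},$$ where $R[w]=\{v\mid wRv\}$. Here and below, conjunctions and disjunctions indexed by worlds are taken over the corresponding sets of formulas, which are finite. **Lemma (provable equivalence of the normal form).** Let $\mathsf X\subseteq\mathsf{Prop}$ be finite. For every formula $\phi$ of $\mathcal{ML}(\subseteq)$ with $\mathsf{Prop}(\phi)\subseteq\mathsf X$ and every $k\ge md(\phi)$ there is a finite nonempty set $\mathcal C$ of pairs $(M,T)$, $M$ a model over $\mathsf X$ and $T$ a team of $M$, such that $$\phi\ \dashv\vdash\ \bigvee_{(M,T)\in\mathcal C}\Big(\bigvee_{w\in T}\chi^k_{M,w}\ \land\bigwedge_{w\in T}(\top\subseteq\chi^k_{M,w})\Big).$$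 Likewise, for $\bullet\in\{\triangledown,\boldsymbol{\cdot}\!\Diamond\}$, every formula $\phi$ of $\mathcal{ML}(\bullet)$ with $\mathsf{Prop}(\phi)\subseteq\mathsf X$ and every $k\ge md(\phi)$ there is such a $\mathcal C$ with $$\phi\ \dashv\vdash\ \bigvee_{(M,T)\in\mathcal C}\Big(\bigvee_{w\in T}\chi^k_{M,w}\ \land\bigwedge_{w\in T}\bullet\chi^k_{M,w}\Big).$$ For $\bullet=\boldsymbol{\cdot}\!\Diamond$ this holds both for the system as listed and for the system in which $\phi$ in rule (i) and $\psi_1,\dots,\psi_n$ in rule (ii) are required to be classical. -/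

import Mathlib

universe u

namespace TeamModal

/-- `[φ₁, …, φₙ] ↦ φ₁ ∘ (φ₂ ∘ (⋯ ∘ φₙ))` for a binary connective `∘`; the value at the empty list
is `e`, and the value at a one-element list is its element. -/
def bigOp {F : Type u} (e : F) (op : F → F → F) : List F → F
  | [] => e
  | [φ] => φ
  | φ :: ψ :: L => op φ (bigOp e op (ψ :: L))

/-! ### Syntax -/

/-- Formulas of the usual modal logic `ML` (the classical formulas) over the propositional symbols
`P`. -/
inductive ML (P : Type u) : Type u
  | var (p : P) : ML P
  | bot : ML P
  | neg (α : ML P) : ML P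
  | or (α β : ML P) : ML P
  | and (α β : ML P) : ML P
  | dia (α : ML P) : ML P
  | box (α : ML P) : ML P

/-- The two might operators: `tri` is the might operator `▽`, `dot` the singular might operator. -/
inductive MightKind
  | tri
  | dot

/-- The three logics: modal inclusion logic and the two modal logics with a might operator. -/
inductive Logic
  | inclusion
  | might (m : MightKind)

/-- `Form P ℓ` is the set of formulas of the logic `ℓ`. Negation is applied to classical formulas
only. In modal inclusion logic there are the inclusion atoms `α₁…αₙ ⊆ β₁…βₙ` (`n ≥ 1`) between
sequences of classical formulas; in `ML(•)` there is the operator `•`, applied to any formula. -/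
inductive Form (P : Type u) : Logic → Type u
  | var {ℓ : Logic} (p : P) : Form P ℓ
  | bot {ℓ : Logic} : Form P ℓ
  | neg {ℓ : Logic} (α : ML P) : Form P ℓ
  | or {ℓ : Logic} (φ ψ : Form P ℓ) : Form P ℓ
  | and {ℓ : Logic} (φ ψ : Form P ℓ) : Form P ℓ
  | dia {ℓ : Logic} (φ : Form P ℓ) : Form P ℓ
  | box {ℓ : Logic} (φ : Form P ℓ) : Form P ℓ
  | incl {n : ℕ} (a b : Fin (n + 1) → ML P) : Form P .inclusion
  | might {m : MightKind} (φ : Form P (.might m)) : Form P (.might m)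

namespace ML

variable {P : Type u}

def top : ML P := .neg .bot

/-- Finite conjunction, `⋀ ∅ = ⊤`. -/
def conj (L : List (ML P)) : ML P := bigOp top .and L

/-- Finite disjunction, `⋁ ∅ = ⊥`. -/
def disj (L : List (ML P)) : ML P := bigOp .bot .or L

/-- The constants `⊤` and `⊥`, coded by `true` and `false`. -/
def const : Bool → ML P
  | true => top
  | false => .bot

/-- `α^x`: `α^⊤ = α` and `α^⊥ = ¬α`. -/
def pow (α : ML P) : Bool → ML P
  | true => α
  | false => .neg α

/-- `𝖺^𝗑 = α₁^{x₁} ∧ … ∧ αₙ^{xₙ}`. -/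
def seqPow {n : ℕ} (a : Fin (n + 1) → ML P) (x : Fin (n + 1) → Bool) : ML P :=
  conj (List.ofFn fun i => (a i).pow (x i))

/-- The propositional symbols that occur in a formula. -/
def symbols : ML P → Set P
  | .var p => {p}
  | .bot => ∅
  | .neg α => α.symbols
  | .or α β => α.symbols ∪ β.symbols
  | .and α β => α.symbols ∪ β.symbols
  | .dia α => α.symbols
  | .box α => α.symbols

/-- Modal depth. -/
def md : ML P → ℕ
  | .var _ => 0
  | .bot => 0
  | .neg α => α.md
  | .or α β => max α.md β.md
  | .and α β => max α.md β.md
  | .dia α => α.md + 1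
  | .box α => α.md + 1

/-- A classical formula as a formula of the logic `ℓ`. -/
def toForm {ℓ : Logic} : ML P → Form P ℓ
  | .var p => .var p
  | .bot => .bot
  | .neg α => .neg α
  | .or α β => .or α.toForm β.toForm
  | .and α β => .and α.toForm β.toForm
  | .dia α => .dia α.toForm
  | .box α => .box α.toForm

end ML

namespace Form

variable {P : Type u}

/-- Finite conjunction, `⋀ ∅ = ⊤`. -/
def conj {ℓ : Logic} (L : List (Form P ℓ)) : Form P ℓ := bigOp (.neg .bot) .and L

/-- Finite disjunction, `⋁ ∅ = ⊥`. -/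
def disj {ℓ : Logic} (L : List (Form P ℓ)) : Form P ℓ := bigOp .bot .or L

/-- The classical formulas of the logic `ℓ`. -/
def IsClassical {ℓ : Logic} (φ : Form P ℓ) : Prop := ∃ α : ML P, φ = α.toForm

/-- The propositional symbols that occur in a formula. -/
def symbols : {ℓ : Logic} → Form P ℓ → Set P
  | _, .var p => {p}
  | _, .bot => ∅
  | _, .neg α => α.symbols
  | _, .or φ ψ => φ.symbols ∪ ψ.symbols
  | _, .and φ ψ => φ.symbols ∪ ψ.symbols
  | _, .dia φ => φ.symbols
  | _, .box φ => φ.symbols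
  | _, .incl a b => ⋃ i, (a i).symbols ∪ (b i).symbols
  | _, .might φ => φ.symbols

/-- Modal depth. -/
def md : {ℓ : Logic} → Form P ℓ → ℕ
  | _, .var _ => 0
  | _, .bot => 0
  | _, .neg α => α.md
  | _, .or φ ψ => max φ.md ψ.md
  | _, .and φ ψ => max φ.md ψ.md
  | _, .dia φ => φ.md + 1
  | _, .box φ => φ.md + 1
  | _, .incl a b => Finset.univ.sup fun i => max (a i).md (b i).md
  | _, .might φ => φ.md

/-- The unary inclusion atom `α ⊆ β`. -/
def incl₁ (α β : ML P) : Form P .inclusion := .incl (n := 0) (fun _ => α) (fun _ => β)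

/-- The primitive inclusion atom `𝗑 ⊆ 𝖺`, where each `xᵢ` is `⊤` or `⊥`. -/
def prim {n : ℕ} (x : Fin (n + 1) → Bool) (a : Fin (n + 1) → ML P) : Form P .inclusion :=
  .incl (fun i => ML.const (x i)) a

/-- The formula `⊤ ⊆ α` of modal inclusion logic, and the formula `•α` of `ML(•)`. -/
def somewhere : (ℓ : Logic) → ML P → Form P ℓ
  | .inclusion, α => incl₁ ML.top α
  | .might _, α => .might α.toForm

end Form

/-- The data of a primitive inclusion atom `𝗑 ⊆ 𝖺`. -/
structure PrimAtom (P : Type u) where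
  n : ℕ
  x : Fin (n + 1) → Bool
  a : Fin (n + 1) → ML P

/-! ### The natural deduction systems -/

/-- Two readings of the rules `diaBoxMightExc` and `mightDiaDistr` for the singular might operator.
In the reading `full` they apply to arbitrary formulas, as for `▽`. With the singular might operator
they are then not sound, so there is also the reading `restricted`, with fewer derivations, in which
the formulas in the scope of the singular might operator in these two rules have to be classical. The
systems of modal inclusion logic and of `ML(▽)` are the same in both readings. -/
inductive Reading
  | full
  | restricted

/-- The formulas to which `diaBoxMightExc` and `mightDiaDistr` apply. -/
def Reading.Admits {P : Type u} (r : Reading) {m : MightKind} (φ : Form P (.might m)) : Prop :=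
  r = .restricted → m = .dot → φ.IsClassical

/-- `Prov r Γ φ`: there is a natural deduction derivation of `φ` all of whose undischarged assumptions
are in `Γ`, in the system of the logic `ℓ`. Where a rule requires the undischarged assumptions of a
subderivation to be classical, these are collected in a set `Δ` of classical formulas from `Γ`. -/
inductive Prov {P : Type u} (r : Reading) : {ℓ : Logic} → Set (Form P ℓ) → Form P ℓ → Prop
  | assumption {ℓ : Logic} {Γ : Set (Form P ℓ)} {φ : Form P ℓ} (h : φ ∈ Γ) : Prov r Γ φ
  /- Rules for classical modal logic, common to the three systems. -/
  | negI {ℓ : Logic} {Γ Δ : Set (Form P ℓ)} {α : ML P}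
      (hΔ : Δ ⊆ Γ) (hc : ∀ δ ∈ Δ, δ.IsClassical)
      (d₀ : Prov r (insert α.toForm Δ) .bot) : Prov r Γ (.neg α)
  | raa {ℓ : Logic} {Γ Δ : Set (Form P ℓ)} {α : ML P}
      (hΔ : Δ ⊆ Γ) (hc : ∀ δ ∈ Δ, δ.IsClassical)
      (d₀ : Prov r (insert (.neg α) Δ) .bot) : Prov r Γ α.toForm
  | negE {ℓ : Logic} {Γ : Set (Form P ℓ)} {α : ML P} {φ : Form P ℓ}
      (d₀ : Prov r Γ α.toForm) (d₁ : Prov r Γ (.neg α)) : Prov r Γ φ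
  | orI_left {ℓ : Logic} {Γ : Set (Form P ℓ)} {φ ψ : Form P ℓ}
      (d : Prov r Γ φ) : Prov r Γ (.or φ ψ)
  | orI_right {ℓ : Logic} {Γ : Set (Form P ℓ)} {φ ψ : Form P ℓ}
      (d : Prov r Γ ψ) : Prov r Γ (.or φ ψ)
  | orE {ℓ : Logic} {Γ Δ : Set (Form P ℓ)} {φ ψ χ : Form P ℓ}
      (d : Prov r Γ (.or φ ψ)) (hΔ : Δ ⊆ Γ) (hc : ∀ δ ∈ Δ, δ.IsClassical)
      (d₀ : Prov r (insert φ Δ) χ) (d₁ : Prov r (insert ψ Δ) χ) : Prov r Γ χ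
  | andI {ℓ : Logic} {Γ : Set (Form P ℓ)} {φ ψ : Form P ℓ}
      (d₀ : Prov r Γ φ) (d₁ : Prov r Γ ψ) : Prov r Γ (.and φ ψ)
  | andE_left {ℓ : Logic} {Γ : Set (Form P ℓ)} {φ ψ : Form P ℓ}
      (d : Prov r Γ (.and φ ψ)) : Prov r Γ φ
  | andE_right {ℓ : Logic} {Γ : Set (Form P ℓ)} {φ ψ : Form P ℓ}
      (d : Prov r Γ (.and φ ψ)) : Prov r Γ ψ
  | diaBoxInter {ℓ : Logic} {Γ : Set (Form P ℓ)} {α : ML P}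
      (d : Prov r Γ (.neg (.box α))) : Prov r Γ (.dia (.neg α))
  | boxDiaInter {ℓ : Logic} {Γ : Set (Form P ℓ)} {α : ML P}
      (d : Prov r Γ (.dia (.neg α))) : Prov r Γ (.neg (.box α))
  | diaOrDistr {ℓ : Logic} {Γ : Set (Form P ℓ)} {φ ψ : Form P ℓ}
      (d : Prov r Γ (.dia (.or φ ψ))) : Prov r Γ (.or (.dia φ) (.dia ψ))
  | boxMon {ℓ : Logic} {Γ : Set (Form P ℓ)} (L : List (Form P ℓ)) {ψ : Form P ℓ}
      (d₀ : Prov r {φ | φ ∈ L} ψ) (d : ∀ φ ∈ L, Prov r Γ (.box φ)) : Prov r Γ (.box ψ)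
  | diaMon {ℓ : Logic} {Γ : Set (Form P ℓ)} {φ ψ : Form P ℓ}
      (d₀ : Prov r {φ} ψ) (d₁ : Prov r Γ (.dia φ)) : Prov r Γ (.dia ψ)
  /- Rules for inclusion atoms. -/
  | inclId {Γ : Set (Form P .inclusion)} {n : ℕ} (a : Fin (n + 1) → ML P) : Prov r Γ (.incl a a)
  | inclExp {Γ : Set (Form P .inclusion)} {n : ℕ} {x : Bool} {α : ML P}
      {b c : Fin (n + 1) → ML P}
      (d₀ : Prov r Γ (α.pow x).toForm) (d₁ : Prov r Γ (.incl b c)) :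
      Prov r Γ (.incl (Matrix.vecCons (ML.const x) b) (Matrix.vecCons α c))
  | inclNegE {Γ : Set (Form P .inclusion)} {n : ℕ} {x : Fin (n + 1) → Bool}
      {a : Fin (n + 1) → ML P} {φ : Form P .inclusion}
      (d₀ : Prov r Γ (.neg (ML.seqPow a x))) (d₁ : Prov r Γ (.prim x a)) : Prov r Γ φ
  | orInclE {Γ : Set (Form P .inclusion)} {n : ℕ} {x : Fin (n + 1) → Bool}
      {a : Fin (n + 1) → ML P} {ψ χ : Form P .inclusion}
      (d : Prov r Γ (.or (.prim x a) ψ))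
      (d₀ : Prov r (insert (.prim x a) Γ) χ) (d₁ : Prov r (insert ψ Γ) χ) : Prov r Γ χ
  | inclExt {Γ : Set (Form P .inclusion)} {n : ℕ} {a b : Fin (n + 1) → ML P}
      (d : Prov r Γ (.conj ((Finset.univ : Finset (Fin (n + 1) → Bool)).toList.map fun x =>
        .or (.neg (ML.seqPow a x)) (.prim x b)))) : Prov r Γ (.incl a b)
  | inclRdt {Γ : Set (Form P .inclusion)} {n : ℕ} {a b : Fin (n + 1) → ML P}
      (x : Fin (n + 1) → Bool) (d : Prov r Γ (.incl a b)) :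
      Prov r Γ (.or (.neg (ML.seqPow a x)) (.prim x b))
  | inclDistr {Γ : Set (Form P .inclusion)} (L : List (PrimAtom P)) {φ ψ : Form P .inclusion}
      (d₀ : Prov r Γ (.or φ ψ)) (d : ∀ ι ∈ L, Prov r Γ (.prim ι.x ι.a)) :
      Prov r Γ (.or ((L.map fun ι => Form.prim ι.x ι.a).foldl .and
        ((L.map fun ι => (ML.seqPow ι.a ι.x).toForm).foldl .or φ)) ψ)
  /- Rules for modal operators and inclusion atoms. -/
  | diaInclDistr {Γ : Set (Form P .inclusion)} {n : ℕ} {x : Fin (n + 1) → Bool}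
      {a : Fin (n + 1) → ML P}
      (d : Prov r Γ (.dia (.prim x a))) : Prov r Γ (.incl₁ ML.top (.dia (ML.seqPow a x)))
  | diaBoxInclExc {Γ : Set (Form P .inclusion)} {n : ℕ} {x : Fin (n + 1) → Bool}
      {a : Fin (n + 1) → ML P}
      (d : Prov r Γ (.incl₁ ML.top (.dia (ML.seqPow a x)))) : Prov r Γ (.box (.prim x a))
  | boxDiaInclExc {Γ : Set (Form P .inclusion)} {n : ℕ} {x : Fin (n + 1) → Bool}
      {a : Fin (n + 1) → ML P} {β : ML P}
      (d₀ : Prov r Γ (.incl₁ ML.top (.dia β))) (d₁ : Prov r Γ (.box (.prim x a))) :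
      Prov r Γ (.incl₁ ML.top (.dia (ML.seqPow a x)))
  | boxOrInclE {Γ : Set (Form P .inclusion)} {n : ℕ} {x : Fin (n + 1) → Bool}
      {a : Fin (n + 1) → ML P} {ψ χ : Form P .inclusion}
      (d : Prov r Γ (.box (.or (.prim x a) ψ)))
      (d₀ : Prov r (insert (.incl₁ ML.top (.dia (ML.seqPow a x))) Γ) χ)
      (d₁ : Prov r (insert (.box ψ) Γ) χ) : Prov r Γ χ
  | inclDiaDistr {Γ : Set (Form P .inclusion)} (L : List (Bool × ML P)) {φ : Form P .inclusion}
      (d₀ : Prov r Γ (.dia φ)) (d : ∀ q ∈ L, Prov r Γ (.incl₁ (ML.const q.1) (.dia q.2))) :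
      Prov r Γ (.dia ((L.map fun q => Form.incl₁ (ML.const q.1) q.2).foldl .and
        ((L.map fun q => (q.2.pow q.1).toForm).foldl .or φ)))
  /- Rules for the might operators: two rules for `▽`, one rule for the singular might operator, and
  the rules that the two operators share. -/
  | triJoin {Γ : Set (Form P (.might .tri))} {φ ψ : Form P (.might .tri)}
      (d₀ : Prov r Γ (.might φ)) (d₁ : Prov r Γ (.might ψ)) :
      Prov r Γ (.might (.and (.and (.or φ ψ) (.might φ)) (.might ψ)))
  | triE {Γ : Set (Form P (.might .tri))} {φ : Form P (.might .tri)}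
      (d : Prov r Γ (.might (.might φ))) : Prov r Γ (.might φ)
  | dotAndSimpl {Γ : Set (Form P (.might .dot))} {φ ψ : Form P (.might .dot)}
      (d : Prov r Γ (.might (.and (.might φ) ψ))) : Prov r Γ (.might (.and φ ψ))
  | mightMon {m : MightKind} {Γ Δ : Set (Form P (.might m))} {φ ψ : Form P (.might m)}
      (d : Prov r Γ (.might φ)) (hΔ : Δ ⊆ Γ) (hc : ∀ δ ∈ Δ, δ.IsClassical)
      (d₀ : Prov r (insert φ Δ) ψ) : Prov r Γ (.might ψ)
  | mightOrDistr {m : MightKind} {Γ : Set (Form P (.might m))} {φ ψ : Form P (.might m)}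
      (d : Prov r Γ (.might (.or φ ψ))) : Prov r Γ (.or (.might φ) (.might ψ))
  | mightI {m : MightKind} {Γ : Set (Form P (.might m))} {α : ML P}
      (d : Prov r Γ α.toForm) : Prov r Γ (.might α.toForm)
  | mightNegE {m : MightKind} {Γ : Set (Form P (.might m))} {α : ML P} {φ : Form P (.might m)}
      (d₀ : Prov r Γ (.neg α)) (d₁ : Prov r Γ (.might α.toForm)) : Prov r Γ φ
  | orMightE {m : MightKind} {Γ : Set (Form P (.might m))} {φ ψ χ : Form P (.might m)}
      (d : Prov r Γ (.or (.might φ) ψ))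
      (d₀ : Prov r (insert (.might φ) Γ) χ) (d₁ : Prov r (insert ψ Γ) χ) : Prov r Γ χ
  | mightDistr {m : MightKind} {Γ : Set (Form P (.might m))} (L : List (Form P (.might m)))
      {φ ψ : Form P (.might m)}
      (d₀ : Prov r Γ (.or φ ψ)) (d : ∀ χ ∈ L, Prov r Γ (.might χ)) :
      Prov r Γ (.or ((L.map .might).foldl .and (L.foldl .or φ)) ψ)
  | boxDiaMightExc {m : MightKind} {Γ : Set (Form P (.might m))} {φ ψ : Form P (.might m)}
      (d₀ : Prov r Γ (.might (.dia ψ))) (d₁ : Prov r Γ (.box (.might φ))) : Prov r Γ (.might (.dia φ))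
  | diaBoxMightExc {m : MightKind} {Γ : Set (Form P (.might m))} {φ : Form P (.might m)}
      (hφ : r.Admits φ) (d : Prov r Γ (.might (.dia φ))) : Prov r Γ (.box (.might φ))
  | boxOrMightE {m : MightKind} {Γ : Set (Form P (.might m))} {φ ψ χ : Form P (.might m)}
      (d : Prov r Γ (.box (.or (.might φ) ψ)))
      (d₀ : Prov r (insert (.might (.dia φ)) Γ) χ) (d₁ : Prov r (insert (.box ψ) Γ) χ) : Prov r Γ χ
  | diaMightDistr {m : MightKind} {Γ : Set (Form P (.might m))} {φ : Form P (.might m)}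
      (d : Prov r Γ (.dia (.might φ))) : Prov r Γ (.might (.dia φ))
  | mightDiaDistr {m : MightKind} {Γ : Set (Form P (.might m))} (L : List (Form P (.might m)))
      {φ : Form P (.might m)}
      (hL : ∀ ψ ∈ L, r.Admits ψ)
      (d₀ : Prov r Γ (.dia φ)) (d : ∀ ψ ∈ L, Prov r Γ (.might (.dia ψ))) :
      Prov r Γ (.dia ((L.map .might).foldl .and (L.foldl .or φ)))

/-- Provable equivalence `φ ⊣⊢ ψ`. -/
def ProvEquiv {P : Type u} {ℓ : Logic} (r : Reading) (φ ψ : Form P ℓ) : Prop :=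
  Prov r {φ} ψ ∧ Prov r {ψ} φ

/-! ### Models, teams and Hintikka formulas -/

/-- Kripke models over a finite set `X` of propositional symbols. -/
structure KripkeModel {P : Type u} (X : Finset P) where
  W : Type u
  R : W → W → Prop
  V : {p // p ∈ X} → Set W

/-- Models with a team over `X`. -/
structure TeamModel {P : Type u} (X : Finset P) where
  M : KripkeModel X
  T : Set M.W

/-- A list of the elements of a finite set, in some fixed order (the empty list if `s` is infinite;
this case does not occur below, see `hintikka_image_finite`). -/
noncomputable def enum {A : Type u} (s : Set A) : List A :=
  open Classical in if h : s.Finite then h.toFinset.toList else []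

theorem mem_enum {A : Type u} {s : Set A} (hs : s.Finite) {a : A} : a ∈ enum s ↔ a ∈ s := by
  simp [enum, hs]

/-- The `k`th Hintikka formula of `(M, w)`. The conjunction and the disjunction over `v ∈ R[w]` are
taken over the set of formulas `{χ^k_v | v ∈ R[w]}`, which is finite (`hintikka_image_finite`). -/
noncomputable def hintikka {P : Type u} {X : Finset P} (M : KripkeModel X) : ℕ → M.W → ML P
  | 0, w => open Classical in
      .and (ML.conj ((X.attach.filter fun p => w ∈ M.V p).toList.map fun p => .var p.1))
        (ML.conj ((X.attach.filter fun p => w ∉ M.V p).toList.map fun p => .neg (.var p.1)))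
  | k + 1, w =>
      .and (.and (hintikka M k w)
        (ML.conj ((enum (hintikka M k '' {v | M.R w v})).map .dia)))
        (.box (ML.disj (enum (hintikka M k '' {v | M.R w v}))))

/-- For given `X` and `k`, there are only finitely many `k`th Hintikka formulas. -/
theorem hintikka_finite {P : Type u} (X : Finset P) (k : ℕ) :
    {α : ML P | ∃ (M : KripkeModel X) (w : M.W), α = hintikka M k w}.Finite := by
  classical
  induction k with
  | zero =>
    refine (Set.finite_range fun s : Finset {p // p ∈ X} => ML.and
      (ML.conj (s.toList.map fun p => .var p.1))
      (ML.conj (sᶜ.toList.map fun p => .neg (.var p.1)))).subset ?_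
    rintro _ ⟨M, w, rfl⟩
    refine ⟨X.attach.filter fun p => w ∈ M.V p, ?_⟩
    have h : (X.attach.filter fun p => w ∈ M.V p)ᶜ = X.attach.filter fun p => w ∉ M.V p := by
      ext p; simp
    simp only [h, hintikka]
  | succ k ih =>
    refine ((ih.prod ih.finite_subsets).image fun q : ML P × Set (ML P) => ML.and
      (.and q.1 (ML.conj ((enum q.2).map .dia))) (.box (ML.disj (enum q.2)))).subset ?_
    rintro _ ⟨M, w, rfl⟩
    refine ⟨(hintikka M k w, hintikka M k '' {v | M.R w v}), ⟨⟨M, w, rfl⟩, ?_⟩, rfl⟩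
    rintro _ ⟨v, -, rfl⟩
    exact ⟨M, v, rfl⟩

theorem hintikka_image_finite {P : Type u} {X : Finset P} (M : KripkeModel X) (k : ℕ)
    (S : Set M.W) : (hintikka M k '' S).Finite :=
  (hintikka_finite X k).subset (by rintro _ ⟨w, -, rfl⟩; exact ⟨M, w, rfl⟩)

/-- The Hintikka formula of a model with a team in the logic `ℓ`:
`⋁_{w ∈ T} χ^k_w ∧ ⋀_{w ∈ T} (⊤ ⊆ χ^k_w)` in modal inclusion logic, and
`⋁_{w ∈ T} χ^k_w ∧ ⋀_{w ∈ T} •χ^k_w` in `ML(•)`. -/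
noncomputable def teamHintikka {P : Type u} {X : Finset P} (ℓ : Logic) (k : ℕ) (A : TeamModel X) :
    Form P ℓ :=
  .and (.disj ((enum (hintikka A.M k '' A.T)).map ML.toForm))
    (.conj ((enum (hintikka A.M k '' A.T)).map (Form.somewhere ℓ)))

end TeamModal

namespace TeamModal

/-! Call the `k`th Hintikka formulas of finite trees types. Provably, types behave like worlds seen
up to depth `k`: there are finitely many, their disjunction is derivable (`types_exhaustive`),
distinct ones refute each other (`types_incompatible`), and each decides every classical formula
over `X` of depth at most `k` (`types_decide`). At depth `k` a team therefore amounts to the set `U`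
of types it realizes, described by `typeTeam ℓ U`. A formula should be equivalent to the disjunction
of the finitely many team formulas that derive it. `HasNormalForm` states this as an elimination
principle, which is proved by induction on the formula. The obstacle is that `∨E` admits only
classical side assumptions, so a disjunction of team formulas cannot be split while another
non-classical formula is kept. Exempt are disjunctions with a disjunct `⊤ ⊆ β` or `•β`.
`HasNormalForm.decompose` splits off such conjuncts of the team formulas one at a time: a disjunct
ends up with all its types realized, or is discarded. The union of the survivors is a single team
formula and, by `typeTeam_flatten`, derives the disjunction of the survivors, hence the original
formula. This case distinction settles conjunctions and, carried out below `□`, boxes. The three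
logics are treated together through `Form.somewhere`; only inclusion atoms and `•` need arguments of
their own. -/

/-! ### Iterated connectives and formulas of bounded depth -/

theorem bigOp_induction {F : Type u} {e : F} {op : F → F → F} {p : F → Prop} (he : p e)
    (hop : ∀ a b, p a → p b → p (op a b)) : ∀ {L : List F}, (∀ a ∈ L, p a) → p (bigOp e op L)
  | [], _ => he
  | [a], h => h a (by simp)
  | a :: b :: L, h => hop _ _ (h a (by simp)) (bigOp_induction he hop fun c hc => h c (by simp_all))

theorem bigOp_map {F G : Type u} {e : F} {op : F → F → F} {e' : G} {op' : G → G → G} {f : F → G}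
    (he : f e = e') (hop : ∀ a b, f (op a b) = op' (f a) (f b)) :
    ∀ L : List F, f (bigOp e op L) = bigOp e' op' (L.map f)
  | [] => he
  | [_] => rfl
  | a :: b :: L => by
    have := bigOp_map he hop (b :: L)
    simp only [bigOp, hop, List.map_cons] at this ⊢
    rw [this]

namespace ML

variable {P : Type u} {ℓ : Logic}

theorem toForm_conj (L : List (ML P)) :
    (conj L).toForm = Form.conj (L.map (toForm (ℓ := ℓ))) :=
  bigOp_map rfl (fun _ _ => rfl) L

theorem toForm_disj (L : List (ML P)) :
    (disj L).toForm = Form.disj (L.map (toForm (ℓ := ℓ))) :=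
  bigOp_map rfl (fun _ _ => rfl) L

/-- The formulas over the symbols in `X` of modal depth at most `k`. -/
def Over (X : Finset P) (k : ℕ) (α : ML P) : Prop := α.symbols ⊆ (X : Set P) ∧ α.md ≤ k

variable {X : Finset P} {k j : ℕ} {α β : ML P}

theorem Over.mono (h : Over X k α) (hk : k ≤ j) : Over X j α := ⟨h.1, h.2.trans hk⟩

theorem over_bot : Over X k (.bot : ML P) := ⟨by simp [symbols], by simp [md]⟩

theorem Over.neg (h : Over X k α) : Over X k (.neg α) := h

theorem over_top : Over X k (top : ML P) := over_bot.neg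

theorem Over.or (h : Over X k α) (h' : Over X k β) : Over X k (.or α β) :=
  ⟨Set.union_subset h.1 h'.1, max_le h.2 h'.2⟩

theorem Over.and (h : Over X k α) (h' : Over X k β) : Over X k (.and α β) :=
  ⟨Set.union_subset h.1 h'.1, max_le h.2 h'.2⟩

theorem Over.dia (h : Over X k α) : Over X (k + 1) (.dia α) := ⟨h.1, Nat.succ_le_succ h.2⟩

theorem Over.box (h : Over X k α) : Over X (k + 1) (.box α) := ⟨h.1, Nat.succ_le_succ h.2⟩

theorem over_conj {L : List (ML P)} (h : ∀ α ∈ L, Over X k α) : Over X k (conj L) :=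
  bigOp_induction over_top (fun _ _ => Over.and) h

theorem over_disj {L : List (ML P)} (h : ∀ α ∈ L, Over X k α) : Over X k (disj L) :=
  bigOp_induction over_bot (fun _ _ => Over.or) h

theorem Over.pow (h : Over X k α) : ∀ x : Bool, Over X k (α.pow x)
  | true => h
  | false => h.neg

theorem over_seqPow {n : ℕ} {a : Fin (n + 1) → ML P} {x : Fin (n + 1) → Bool}
    (h : ∀ i, Over X k (a i)) : Over X k (seqPow a x) :=
  over_conj fun α hα => by
    obtain ⟨i, rfl⟩ := List.mem_ofFn.1 hα
    exact (h i).pow _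

theorem seqPow_singleton (α : ML P) :
    seqPow (n := 0) (fun _ => α) (fun _ => true) = α := by
  simp [seqPow, conj, bigOp, pow]

end ML

/-! ### Structural properties of derivations -/

namespace Prov

variable {P : Type u} {r : Reading} {ℓ : Logic} {Γ Δ : Set (Form P ℓ)} {φ ψ χ φ' ψ' : Form P ℓ}

theorem weaken (d : Prov r Γ φ) : ∀ {Γ' : Set (Form P ℓ)}, Γ ⊆ Γ' → Prov r Γ' φ := by
  induction d with
  | assumption h => exact fun s => .assumption (s h)
  | negI hΔ hc d => exact fun s => .negI (hΔ.trans s) hc d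
  | raa hΔ hc d => exact fun s => .raa (hΔ.trans s) hc d
  | negE _ _ h₀ h₁ => exact fun s => .negE (h₀ s) (h₁ s)
  | orI_left _ h => exact fun s => .orI_left (h s)
  | orI_right _ h => exact fun s => .orI_right (h s)
  | orE _ hΔ hc d₀ d₁ h => exact fun s => .orE (h s) (hΔ.trans s) hc d₀ d₁
  | andI _ _ h₀ h₁ => exact fun s => .andI (h₀ s) (h₁ s)
  | andE_left _ h => exact fun s => .andE_left (h s)
  | andE_right _ h => exact fun s => .andE_right (h s)
  | diaBoxInter _ h => exact fun s => .diaBoxInter (h s)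
  | boxDiaInter _ h => exact fun s => .boxDiaInter (h s)
  | diaOrDistr _ h => exact fun s => .diaOrDistr (h s)
  | boxMon L d₀ _ _ h => exact fun s => .boxMon L d₀ fun φ hφ => h φ hφ s
  | diaMon d₀ _ _ h => exact fun s => .diaMon d₀ (h s)
  | inclId a => exact fun _ => .inclId a
  | inclExp _ _ h₀ h₁ => exact fun s => .inclExp (h₀ s) (h₁ s)
  | inclNegE _ _ h₀ h₁ => exact fun s => .inclNegE (h₀ s) (h₁ s)
  | orInclE _ _ _ h h₀ h₁ =>
    exact fun s => .orInclE (h s) (h₀ (Set.insert_subset_insert s)) (h₁ (Set.insert_subset_insert s))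
  | inclExt _ h => exact fun s => .inclExt (h s)
  | inclRdt x _ h => exact fun s => .inclRdt x (h s)
  | inclDistr L _ _ h₀ h => exact fun s => .inclDistr L (h₀ s) fun ι hι => h ι hι s
  | diaInclDistr _ h => exact fun s => .diaInclDistr (h s)
  | diaBoxInclExc _ h => exact fun s => .diaBoxInclExc (h s)
  | boxDiaInclExc _ _ h₀ h₁ => exact fun s => .boxDiaInclExc (h₀ s) (h₁ s)
  | boxOrInclE _ _ _ h h₀ h₁ =>
    exact fun s =>
      .boxOrInclE (h s) (h₀ (Set.insert_subset_insert s)) (h₁ (Set.insert_subset_insert s))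
  | inclDiaDistr L _ _ h₀ h => exact fun s => .inclDiaDistr L (h₀ s) fun ι hι => h ι hι s
  | triJoin _ _ h₀ h₁ => exact fun s => .triJoin (h₀ s) (h₁ s)
  | triE _ h => exact fun s => .triE (h s)
  | dotAndSimpl _ h => exact fun s => .dotAndSimpl (h s)
  | mightMon _ hΔ hc d h => exact fun s => .mightMon (h s) (hΔ.trans s) hc d
  | mightOrDistr _ h => exact fun s => .mightOrDistr (h s)
  | mightI _ h => exact fun s => .mightI (h s)
  | mightNegE _ _ h₀ h₁ => exact fun s => .mightNegE (h₀ s) (h₁ s)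
  | orMightE _ _ _ h h₀ h₁ =>
    exact fun s => .orMightE (h s) (h₀ (Set.insert_subset_insert s)) (h₁ (Set.insert_subset_insert s))
  | mightDistr L _ _ h₀ h => exact fun s => .mightDistr L (h₀ s) fun ι hι => h ι hι s
  | boxDiaMightExc _ _ h₀ h₁ => exact fun s => .boxDiaMightExc (h₀ s) (h₁ s)
  | diaBoxMightExc hφ _ h => exact fun s => .diaBoxMightExc hφ (h s)
  | boxOrMightE _ _ _ h h₀ h₁ =>
    exact fun s =>
      .boxOrMightE (h s) (h₀ (Set.insert_subset_insert s)) (h₁ (Set.insert_subset_insert s))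
  | diaMightDistr _ h => exact fun s => .diaMightDistr (h s)
  | mightDiaDistr L hL _ _ h₀ h => exact fun s => .mightDiaDistr L hL (h₀ s) fun ι hι => h ι hι s

theorem self : Prov r {φ} φ := .assumption rfl

theorem head : Prov r (insert φ Γ) φ := .assumption (Set.mem_insert _ _)

/-- There is no implication to discharge `φ` with; eliminating `φ ∨ φ` does it, at the price of a
classical side context. -/
theorem cut (hΔ : Δ ⊆ Γ) (hc : ∀ δ ∈ Δ, δ.IsClassical) (d : Prov r Γ φ)
    (e : Prov r (insert φ Δ) ψ) : Prov r Γ ψ :=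
  .orE (.orI_left (ψ := φ) d) hΔ hc e e

theorem trans (d : Prov r Γ φ) (e : Prov r {φ} ψ) : Prov r Γ ψ :=
  cut (Set.empty_subset Γ) (by simp) d (e.weaken (by simp))

theorem botE (d : Prov r Γ .bot) : Prov r Γ φ :=
  .negE (α := .bot) d (.negI (Set.empty_subset Γ) (by simp) head)

theorem or_elim (d : Prov r Γ (.or φ ψ)) (d₀ : Prov r {φ} χ) (d₁ : Prov r {ψ} χ) : Prov r Γ χ :=
  .orE d (Set.empty_subset Γ) (by simp) (d₀.weaken (by simp)) (d₁.weaken (by simp))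

theorem or_mono (d : Prov r Γ (.or φ ψ)) (d₀ : Prov r {φ} φ') (d₁ : Prov r {ψ} ψ') :
    Prov r Γ (.or φ' ψ') :=
  d.or_elim d₀.orI_left d₁.orI_right

theorem or_comm (d : Prov r Γ (.or φ ψ)) : Prov r Γ (.or ψ φ) :=
  d.or_elim (.orI_right self) (.orI_left self)

theorem top : Prov r Γ (.neg .bot) := .negI (Set.empty_subset Γ) (by simp) head

theorem disj_intro {L : List (Form P ℓ)} : φ ∈ L → Prov r Γ φ → Prov r Γ (.disj L) := by
  induction L with
  | nil => simp
  | cons ψ L ih =>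
    intro h d
    cases L with
    | nil =>
      obtain rfl : φ = ψ := by simpa using h
      exact d
    | cons ψ' L =>
      rcases List.mem_cons.1 h with rfl | h
      · exact .orI_left d
      · exact .orI_right (ih h d)

theorem disj_elim {L : List (Form P ℓ)} (hΔ : Δ ⊆ Γ) (hc : ∀ δ ∈ Δ, δ.IsClassical)
    (d : Prov r Γ (.disj L)) (h : ∀ φ ∈ L, Prov r (insert φ Δ) χ) : Prov r Γ χ := by
  induction L generalizing Γ with
  | nil => exact botE d
  | cons ψ L ih =>
    cases L with
    | nil => exact cut hΔ hc d (h ψ (by simp))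
    | cons ψ' L =>
      exact .orE d hΔ hc (h ψ (by simp))
        (ih (Set.subset_insert _ _) head fun φ hφ => h φ (List.mem_cons_of_mem _ hφ))

theorem disj_elim' {L : List (Form P ℓ)} (d : Prov r Γ (.disj L)) (h : ∀ φ ∈ L, Prov r {φ} χ) :
    Prov r Γ χ :=
  disj_elim (Set.empty_subset Γ) (by simp) d fun φ hφ => (h φ hφ).weaken (by simp)

theorem disj_mono {L L' : List (Form P ℓ)} (d : Prov r Γ (.disj L))
    (h : ∀ φ ∈ L, ∃ ψ ∈ L', Prov r {φ} ψ) : Prov r Γ (.disj L') :=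
  d.disj_elim' fun φ hφ => let ⟨_, hψ, e⟩ := h φ hφ; disj_intro hψ e

theorem disj_cons {L : List (Form P ℓ)} (d : Prov r Γ (.disj (φ :: L))) :
    Prov r Γ (.or φ (.disj L)) :=
  d.disj_elim' fun ψ hψ => by
    rcases List.mem_cons.1 hψ with rfl | hψ
    · exact .orI_left self
    · exact .orI_right (disj_intro hψ self)

theorem disj_of_or {L : List (Form P ℓ)} (d : Prov r Γ (.or φ (.disj L))) :
    Prov r Γ (.disj (φ :: L)) :=
  d.or_elim (disj_intro (by simp) self)
    (disj_mono self fun ψ hψ => ⟨ψ, List.mem_cons_of_mem _ hψ, self⟩)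

theorem conj_intro {L : List (Form P ℓ)} (h : ∀ φ ∈ L, Prov r Γ φ) : Prov r Γ (.conj L) :=
  bigOp_induction (p := Prov r Γ) top (fun _ _ => .andI) h

theorem conj_elim {L : List (Form P ℓ)} (d : Prov r Γ (.conj L)) : ∀ φ ∈ L, Prov r Γ φ := by
  induction L with
  | nil => simp
  | cons ψ L ih =>
    cases L with
    | nil =>
      intro φ hφ
      obtain rfl : φ = ψ := by simpa using hφ
      exact d
    | cons ψ' L =>
      intro φ hφ
      rcases List.mem_cons.1 hφ with rfl | hφ
      · exact .andE_left d
      · exact ih (.andE_right d) φ hφ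

theorem foldl_and_elim {L : List (Form P ℓ)} (d : Prov r Γ (L.foldl .and φ)) :
    Prov r Γ φ ∧ ∀ ψ ∈ L, Prov r Γ ψ := by
  induction L generalizing φ with
  | nil => exact ⟨d, by simp⟩
  | cons ψ L ih =>
    obtain ⟨h, h'⟩ := ih d
    exact ⟨.andE_left h, by simpa using ⟨.andE_right h, h'⟩⟩

theorem foldl_or_elim {L : List (Form P ℓ)} (d : Prov r Γ (L.foldl .or φ)) (h : Prov r {φ} χ)
    (h' : ∀ ψ ∈ L, Prov r {ψ} χ) : Prov r Γ χ := by
  induction L generalizing φ with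
  | nil => exact d.trans h
  | cons ψ L ih =>
    exact ih d (or_elim self h (h' ψ (by simp))) fun ψ' hψ' => h' ψ' (List.mem_cons_of_mem _ hψ')

end Prov

/-! ### Classical sequents -/

/-- Derivability of a classical formula from classical formulas in the system of `ℓ`. -/
def Cl {P : Type u} (r : Reading) (ℓ : Logic) (A : Set (ML P)) (α : ML P) : Prop :=
  Prov (ℓ := ℓ) r (ML.toForm '' A) α.toForm

namespace Cl

variable {P : Type u} {r : Reading} {ℓ : Logic} {A B : Set (ML P)} {α β γ : ML P}

theorem isClassical_of_mem_image : ∀ δ ∈ ML.toForm (ℓ := ℓ) '' A, δ.IsClassical := by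
  rintro _ ⟨α, -, rfl⟩
  exact ⟨α, rfl⟩

theorem prov (h : Cl r ℓ {α} β) : Prov (ℓ := ℓ) r {α.toForm} β.toForm := by
  simpa [Cl] using h

theorem hyp (h : α ∈ A) : Cl r ℓ A α := Prov.assumption ⟨α, h, rfl⟩

theorem head : Cl r ℓ (insert α A) α := hyp (Set.mem_insert _ _)

theorem self : Cl r ℓ {α} α := hyp rfl

theorem weaken (h : Cl r ℓ A α) (s : A ⊆ B) : Cl r ℓ B α := Prov.weaken h (Set.image_mono s)

theorem cut (h : Cl r ℓ A α) (h' : Cl r ℓ (insert α A) β) : Cl r ℓ A β :=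
  Prov.cut subset_rfl isClassical_of_mem_image h (by rwa [Cl, Set.image_insert_eq] at h')

theorem trans (h : Cl r ℓ A α) (h' : Cl r ℓ {α} β) : Cl r ℓ A β :=
  h.cut (h'.weaken (by simp))

theorem negI (h : Cl r ℓ (insert α A) .bot) : Cl r ℓ A (.neg α) :=
  Prov.negI subset_rfl isClassical_of_mem_image (by rwa [Cl, Set.image_insert_eq] at h)

theorem raa (h : Cl r ℓ (insert (.neg α) A) .bot) : Cl r ℓ A α :=
  Prov.raa subset_rfl isClassical_of_mem_image (by rwa [Cl, Set.image_insert_eq] at h)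

theorem negE (h : Cl r ℓ A α) (h' : Cl r ℓ A (.neg α)) : Cl r ℓ A β := Prov.negE h h'

theorem andI (h : Cl r ℓ A α) (h' : Cl r ℓ A β) : Cl r ℓ A (.and α β) := Prov.andI h h'

theorem left (h : Cl r ℓ A (.and α β)) : Cl r ℓ A α := Prov.andE_left h

theorem right (h : Cl r ℓ A (.and α β)) : Cl r ℓ A β := Prov.andE_right h

theorem inl (h : Cl r ℓ A α) : Cl r ℓ A (.or α β) := Prov.orI_left h

theorem inr (h : Cl r ℓ A β) : Cl r ℓ A (.or α β) := Prov.orI_right h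

theorem orE (h : Cl r ℓ A (.or α β)) (h₀ : Cl r ℓ (insert α A) γ) (h₁ : Cl r ℓ (insert β A) γ) :
    Cl r ℓ A γ :=
  Prov.orE h subset_rfl isClassical_of_mem_image (by rwa [Cl, Set.image_insert_eq] at h₀)
    (by rwa [Cl, Set.image_insert_eq] at h₁)

theorem top : Cl r ℓ A ML.top := Prov.top

theorem em : Cl r ℓ A (.or α (.neg α)) :=
  raa (negE (inr (negI (negE (inl head) (hyp (.inr (.inl rfl)))))) head)

theorem cases (h₀ : Cl r ℓ (insert α A) γ) (h₁ : Cl r ℓ (insert (.neg α) A) γ) : Cl r ℓ A γ :=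
  em.orE h₀ h₁

/-- Excluded middle along `L`: the enlarged context `B` serves as a truth assignment on `L`. -/
theorem cases_list (L : List (ML P))
    (h : ∀ B, A ⊆ B → (∀ α ∈ L, α ∈ B ∨ .neg α ∈ B) → Cl r ℓ B γ) : Cl r ℓ A γ := by
  induction L generalizing A with
  | nil => exact h A subset_rfl (by simp)
  | cons α L ih =>
    refine cases (α := α) ?_ ?_ <;> refine ih fun B hB hL => ?_
    all_goals
      have := hB (Set.mem_insert _ _)
      refine h B ((Set.subset_insert _ _).trans hB) ?_
      simp_all

theorem disj_intro {L : List (ML P)} (hα : α ∈ L) (h : Cl r ℓ A α) : Cl r ℓ A (ML.disj L) := by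
  rw [Cl, ML.toForm_disj]
  exact Prov.disj_intro (List.mem_map_of_mem hα) h

theorem disj_elim {L : List (ML P)} (h : Cl r ℓ A (ML.disj L))
    (h' : ∀ α ∈ L, Cl r ℓ (insert α A) γ) : Cl r ℓ A γ := by
  rw [Cl, ML.toForm_disj] at h
  refine Prov.disj_elim subset_rfl isClassical_of_mem_image h fun φ hφ => ?_
  obtain ⟨α, hα, rfl⟩ := List.mem_map.1 hφ
  simpa only [Cl, Set.image_insert_eq] using h' α hα

theorem conj_intro {L : List (ML P)} (h : ∀ α ∈ L, Cl r ℓ A α) : Cl r ℓ A (ML.conj L) :=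
  bigOp_induction (p := Cl r ℓ A) top (fun _ _ => andI) h

theorem conj_elim {L : List (ML P)} (h : Cl r ℓ A (ML.conj L)) (hα : α ∈ L) : Cl r ℓ A α := by
  rw [Cl, ML.toForm_conj] at h
  exact h.conj_elim _ (List.mem_map_of_mem hα)

theorem negneg (h : Cl r ℓ A α) : Cl r ℓ A (.neg (.neg α)) :=
  negI (negE (h.weaken (Set.subset_insert _ _)) head)

theorem of_negneg (h : Cl r ℓ A (.neg (.neg α))) : Cl r ℓ A α :=
  raa (negE head (h.weaken (Set.subset_insert _ _)))

theorem diaMon (h : Cl r ℓ A (.dia α)) (h' : Cl r ℓ {α} β) : Cl r ℓ A (.dia β) :=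
  Prov.diaMon h'.prov h

theorem boxMon (L : List (ML P)) (h' : Cl r ℓ {α | α ∈ L} β) (h : ∀ α ∈ L, Cl r ℓ A (.box α)) :
    Cl r ℓ A (.box β) := by
  refine Prov.boxMon (L.map ML.toForm) (Prov.weaken h' ?_) ?_
  · rintro _ ⟨α, hα, rfl⟩
    exact List.mem_map_of_mem hα
  · intro φ hφ
    obtain ⟨α, hα, rfl⟩ := List.mem_map.1 hφ
    exact h α hα

theorem boxMon₁ (h : Cl r ℓ A (.box α)) (h' : Cl r ℓ {α} β) : Cl r ℓ A (.box β) :=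
  boxMon [α] (h'.weaken (by simp)) (by simpa using h)

theorem neg_box (h : Cl r ℓ A (.dia (.neg α))) : Cl r ℓ A (.neg (.box α)) := Prov.boxDiaInter h

theorem dia_neg (h : Cl r ℓ A (.neg (.box α))) : Cl r ℓ A (.dia (.neg α)) := Prov.diaBoxInter h

theorem neg_dia (h : Cl r ℓ A (.box (.neg α))) : Cl r ℓ A (.neg (.dia α)) :=
  negI (negE (h.weaken (Set.subset_insert _ _)) (neg_box (head.diaMon self.negneg)))

theorem box_neg (h : Cl r ℓ A (.neg (.dia α))) : Cl r ℓ A (.box (.neg α)) :=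
  raa (negE ((dia_neg head).diaMon self.of_negneg) (h.weaken (Set.subset_insert _ _)))

theorem contrapose (h : Cl r ℓ A (.neg β)) (h' : Cl r ℓ {α} β) : Cl r ℓ A (.neg α) :=
  negI (negE (head.trans h') (h.weaken (Set.subset_insert _ _)))

end Cl
/-! ### Hintikka formulas -/

section Hintikka

variable {P : Type u} {r : Reading} {ℓ : Logic} {X : Finset P} {M : KripkeModel X} {k j : ℕ}
  {w w' : M.W} {A : Set (ML P)} {α : ML P}

theorem hintikka_zero_var {p : {p // p ∈ X}} (hw : w ∈ M.V p) :
    Cl r ℓ {hintikka M 0 w} (.var p.1) := by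
  classical
  refine Cl.self.left.conj_elim ?_
  simp [hw]

theorem hintikka_zero_neg_var {p : {p // p ∈ X}} (hw : w ∉ M.V p) :
    Cl r ℓ {hintikka M 0 w} (.neg (.var p.1)) := by
  classical
  refine Cl.self.right.conj_elim ?_
  simp [hw]

theorem hintikka_zero_intro (h : ∀ p : {p // p ∈ X}, w ∈ M.V p → Cl r ℓ A (.var p.1))
    (h' : ∀ p : {p // p ∈ X}, w ∉ M.V p → Cl r ℓ A (.neg (.var p.1))) :
    Cl r ℓ A (hintikka M 0 w) := by
  classical
  refine Cl.andI (Cl.conj_intro fun α hα => ?_) (Cl.conj_intro fun α hα => ?_)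
  all_goals
    simp only [List.mem_map, Finset.mem_toList, Finset.mem_filter] at hα
    obtain ⟨p, ⟨-, hp⟩, rfl⟩ := hα
  exacts [h p hp, h' p hp]

theorem mem_enum_image {S : Set M.W} :
    α ∈ enum (hintikka M k '' S) ↔ ∃ v ∈ S, hintikka M k v = α :=
  mem_enum (hintikka_image_finite M k S)

theorem hintikka_succ : Cl r ℓ {hintikka M (k + 1) w} (hintikka M k w) := Cl.self.left.left

theorem hintikka_dia {v : M.W} (hv : M.R w v) :
    Cl r ℓ {hintikka M (k + 1) w} (.dia (hintikka M k v)) :=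
  Cl.self.left.right.conj_elim (List.mem_map_of_mem (mem_enum_image.2 ⟨v, hv, rfl⟩))

theorem hintikka_box (h : ∀ v, M.R w v → Cl r ℓ {hintikka M k v} α) :
    Cl r ℓ {hintikka M (k + 1) w} (.box α) := by
  refine (Cl.self.right : Cl r ℓ {hintikka M (k + 1) w} _).boxMon₁ (Cl.self.disj_elim fun β hβ => ?_)
  obtain ⟨v, hv, rfl⟩ := mem_enum_image.1 hβ
  exact Cl.head.trans (h v hv)

theorem hintikka_succ_intro (h : Cl r ℓ A (hintikka M k w))
    (hd : ∀ v, M.R w v → Cl r ℓ A (.dia (hintikka M k v)))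
    (hb : Cl r ℓ A (.box (ML.disj (enum (hintikka M k '' {v | M.R w v}))))) :
    Cl r ℓ A (hintikka M (k + 1) w) := by
  refine (h.andI (Cl.conj_intro fun α hα => ?_)).andI hb
  obtain ⟨β, hβ, rfl⟩ := List.mem_map.1 hα
  obtain ⟨v, hv, rfl⟩ := mem_enum_image.1 hβ
  exact hd v hv

theorem hintikka_le (h : j ≤ k) : Cl r ℓ {hintikka M k w} (hintikka M j w) := by
  induction k, h using Nat.le_induction with
  | base => exact Cl.self
  | succ k _ ih => exact hintikka_succ.trans ih

theorem hintikka_over (M : KripkeModel X) (k : ℕ) (w : M.W) : (hintikka M k w).Over X k := by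
  induction k generalizing w with
  | zero =>
    refine ML.Over.and (ML.over_conj fun α hα => ?_) (ML.over_conj fun α hα => ?_)
    all_goals
      obtain ⟨p, -, rfl⟩ := List.mem_map.1 hα
      simp [ML.Over, ML.symbols, ML.md]
  | succ k ih =>
    refine (((ih w).mono k.le_succ).and (ML.over_conj fun α hα => ?_)).and
      (ML.Over.box (ML.over_disj fun α hα => ?_))
    · obtain ⟨β, hβ, rfl⟩ := List.mem_map.1 hα
      obtain ⟨v, -, rfl⟩ := mem_enum_image.1 hβ
      exact (ih v).dia
    · obtain ⟨v, -, rfl⟩ := mem_enum_image.1 hα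
      exact ih v

/-- In the case of `◇α`, either some successor's formula derives `α`, or by induction all derive
`¬α` and the box conjunct turns this into `¬◇α`; `□α` is dual. -/
theorem hintikka_decides (α : ML P) : ∀ {k : ℕ} {w : M.W}, α.Over X k →
    Cl r ℓ {hintikka M k w} α ∨ Cl r ℓ {hintikka M k w} (.neg α) := by
  induction α with
  | var p =>
    intro k w h
    have hp : p ∈ X := by simpa [ML.Over, ML.symbols, ML.md] using h
    by_cases hw : w ∈ M.V ⟨p, hp⟩
    · exact .inl ((hintikka_le k.zero_le).trans (hintikka_zero_var hw))
    · exact .inr ((hintikka_le k.zero_le).trans (hintikka_zero_neg_var hw))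
  | bot => exact fun _ => .inr .top
  | neg α ih => exact fun h => (ih h).elim (fun h => .inr h.negneg) .inl
  | or α β ihα ihβ =>
    intro k w h
    have hα : α.Over X k := ⟨Set.subset_union_left.trans h.1, (le_max_left _ _).trans h.2⟩
    have hβ : β.Over X k := ⟨Set.subset_union_right.trans h.1, (le_max_right _ _).trans h.2⟩
    rcases ihα (w := w) hα with h | h
    · exact .inl h.inl
    rcases ihβ (w := w) hβ with h' | h'
    · exact .inl h'.inr
    · exact .inr (.negI (Cl.head.orE (Cl.negE Cl.head (h.weaken (by simp)))
        (Cl.negE Cl.head (h'.weaken (by simp)))))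
  | and α β ihα ihβ =>
    intro k w h
    have hα : α.Over X k := ⟨Set.subset_union_left.trans h.1, (le_max_left _ _).trans h.2⟩
    have hβ : β.Over X k := ⟨Set.subset_union_right.trans h.1, (le_max_right _ _).trans h.2⟩
    rcases ihα (w := w) hα with h | h
    · rcases ihβ (w := w) hβ with h' | h'
      · exact .inl (h.andI h')
      · exact .inr (h'.contrapose Cl.self.right)
    · exact .inr (h.contrapose Cl.self.left)
  | dia α ih =>
    rintro (_ | k) w ⟨hs, hd⟩
    · simp [ML.md] at hd
    have hα : α.Over X k := ⟨hs, Nat.succ_le_succ_iff.1 hd⟩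
    by_cases hv : ∃ v, M.R w v ∧ Cl r ℓ {hintikka M k v} α
    · obtain ⟨v, hv, h⟩ := hv
      exact .inl ((hintikka_dia hv).diaMon h)
    · push Not at hv
      exact .inr (Cl.neg_dia (hintikka_box fun v h => (ih hα).resolve_left (hv v h)))
  | box α ih =>
    rintro (_ | k) w ⟨hs, hd⟩
    · simp [ML.md] at hd
    have hα : α.Over X k := ⟨hs, Nat.succ_le_succ_iff.1 hd⟩
    by_cases hv : ∃ v, M.R w v ∧ Cl r ℓ {hintikka M k v} (.neg α)
    · obtain ⟨v, hv, h⟩ := hv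
      exact .inr (Cl.neg_box ((hintikka_dia hv).diaMon h))
    · push Not at hv
      exact .inl (hintikka_box fun v h => (ih hα).resolve_right (hv v h))

/-- If the formulas agree one level below, their sets of successor formulas differ. A `γ` in only
one set yields `◇γ` on that side, while on the other side every successor refutes `γ` by induction.
-/
theorem hintikka_incompatible (h : hintikka M k w ≠ hintikka M k w') :
    Cl r ℓ {hintikka M k w} (.neg (hintikka M k w')) := by
  induction k generalizing w w' with
  | zero =>
    have : ∃ p, ¬(w ∈ M.V p ↔ w' ∈ M.V p) := by
      by_contra! h'
      classical
      refine h ?_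
      simp only [hintikka]
      rw [Finset.filter_congr fun p _ => h' p, Finset.filter_congr fun p _ => not_congr (h' p)]
    obtain ⟨p, hp⟩ := this
    by_cases hw : w ∈ M.V p
    · have hw' : w' ∉ M.V p := by tauto
      exact .negI (Cl.negE ((hintikka_zero_var hw).weaken (by simp))
        (Cl.head.trans (hintikka_zero_neg_var hw')))
    · have hw' : w' ∈ M.V p := by tauto
      exact (hintikka_zero_neg_var hw).contrapose (hintikka_zero_var hw')
  | succ k ih =>
    by_cases hk : hintikka M k w = hintikka M k w'
    swap
    · exact (hintikka_succ.trans (ih hk)).contrapose hintikka_succ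
    have key : ∀ {w w' : M.W} {γ}, γ ∈ hintikka M k '' {v | M.R w v} →
        γ ∉ hintikka M k '' {v | M.R w' v} → Cl r ℓ {hintikka M (k + 1) w} (.dia γ) ∧
          Cl r ℓ {hintikka M (k + 1) w'} (.neg (.dia γ)) := by
      rintro w w' _ ⟨v, hv, rfl⟩ h
      refine ⟨hintikka_dia hv, Cl.neg_dia (hintikka_box fun v' hv' => ih fun h' => h ⟨v', hv', h'⟩)⟩
    have : hintikka M k '' {v | M.R w v} ≠ hintikka M k '' {v | M.R w' v} := by
      intro h'
      exact h (by simp only [hintikka, hk, h'])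
    rw [Ne, Set.ext_iff, not_forall] at this
    obtain ⟨γ, hγ⟩ := this
    by_cases h₁ : γ ∈ hintikka M k '' {v | M.R w v}
    · have h₂ : γ ∉ hintikka M k '' {v | M.R w' v} := by tauto
      exact .negI (Cl.negE ((key h₁ h₂).1.weaken (by simp)) (Cl.head.trans (key h₁ h₂).2))
    · have h₂ : γ ∈ hintikka M k '' {v | M.R w' v} := by tauto
      exact (key h₂ h₁).2.contrapose (key h₂ h₁).1

end Hintikka

/-! ### A universal model -/

/-- Finite trees labelled by valuations over `X`. -/
inductive Tree {P : Type u} (X : Finset P) : Type u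
  | node (v : Set {p // p ∈ X}) (n : ℕ) (c : Fin n → Tree X) : Tree X

/-- The model whose worlds are the finite trees; a tree sees its immediate subtrees. -/
def treeModel {P : Type u} (X : Finset P) : KripkeModel X where
  W := Tree X
  R := fun | .node _ _ c, t => t ∈ Set.range c
  V := fun p => {t | match t with | .node v _ _ => p ∈ v}

section Types

variable {P : Type u} {r : Reading} {ℓ : Logic} {X : Finset P} {k : ℕ}

/-- The `k`th Hintikka formulas of finite trees. -/
def types (X : Finset P) (k : ℕ) : Set (ML P) := Set.range (hintikka (treeModel X) k)

theorem types_finite (X : Finset P) (k : ℕ) : (types X k).Finite :=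
  (hintikka_finite X k).subset (by rintro _ ⟨w, rfl⟩; exact ⟨_, w, rfl⟩)

theorem mem_enum_types {α : ML P} : α ∈ enum (types X k) ↔ α ∈ types X k :=
  mem_enum (types_finite X k)

theorem over_of_mem_types {α : ML P} (h : α ∈ types X k) : α.Over X k := by
  obtain ⟨w, rfl⟩ := h
  exact hintikka_over _ _ _

theorem types_decide {β α : ML P} (h : β ∈ types X k) (hα : α.Over X k) :
    Cl r ℓ {β} α ∨ Cl r ℓ {β} (.neg α) := by
  obtain ⟨w, rfl⟩ := h
  exact hintikka_decides α hα

theorem types_incompatible {β γ : ML P} (h : β ∈ types X k) (h' : γ ∈ types X k) (hne : β ≠ γ) :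
    Cl r ℓ {β} (.neg γ) := by
  obtain ⟨w, rfl⟩ := h
  obtain ⟨w', rfl⟩ := h'
  exact hintikka_incompatible hne

/-- Every valuation and every finite set of successors occurs at some root. Thus one model holds all
types, as needed for `hintikka_incompatible`, which compares worlds of the same model. -/
theorem exists_tree (v : Set {p // p ∈ X}) {s : Set (Tree X)} (hs : s.Finite) :
    ∃ t : Tree X, (∀ p, t ∈ (treeModel X).V p ↔ p ∈ v) ∧
      ∀ t', (treeModel X).R t t' ↔ t' ∈ s := by
  obtain ⟨n, c, hc⟩ := hs.fin_param
  obtain ⟨-, rfl⟩ := hc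
  exact ⟨.node v n c, fun p => Iff.rfl, fun t' => Iff.rfl⟩

/-- By cases, the context decides each symbol of `X` and each `◇γ` with `γ` a type one level below.
The tree with this valuation and one child of type `γ` for each assumed `◇γ` has its Hintikka
formula derivable. -/
theorem types_exhaustive (X : Finset P) (k : ℕ) {A : Set (ML P)} :
    Cl r ℓ A (ML.disj (enum (types X k))) := by
  induction k generalizing A with
  | zero =>
    refine Cl.cases_list (X.toList.map .var) fun B _ hB => ?_
    obtain ⟨t, ht, -⟩ := exists_tree {p : {p // p ∈ X} | .var p.1 ∈ B} Set.finite_empty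
    refine Cl.disj_intro (mem_enum_types.2 ⟨t, rfl⟩) (hintikka_zero_intro ?_ ?_) <;> intro p hp
    · exact Cl.hyp ((ht p).1 hp)
    · exact Cl.hyp ((hB (.var p.1) (List.mem_map_of_mem (by simp))).resolve_left (mt (ht p).2 hp))
  | succ k ih =>
    classical
    refine Cl.cases_list (X.toList.map .var ++ (enum (types X k)).map .dia) fun B _ hB => ?_
    have : Nonempty (treeModel X).W := ⟨.node ∅ 0 Fin.elim0⟩
    choose! f hf using fun α (h : α ∈ types X k) => h
    have hfin : (f '' {γ | γ ∈ types X k ∧ .dia γ ∈ B}).Finite :=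
      ((types_finite X k).subset fun γ hγ => hγ.1).image f
    obtain ⟨t, ht, hR⟩ := exists_tree {p : {p // p ∈ X} | .var p.1 ∈ B} hfin
    -- Below `□` all types are available by induction; those with `◇γ ∉ B` are excluded by `□¬γ`.
    have hbox : Cl r ℓ B (.box (ML.disj (enum (hintikka (treeModel X) k '' {v | (treeModel X).R t v})))) := by
      refine Cl.boxMon (((enum (types X k)).filter fun γ =>
        ML.dia γ ∉ B).map .neg) ?_ ?_
      · refine ih.disj_elim fun γ hγ => ?_
        by_cases hγB : .dia γ ∈ B
        · refine Cl.disj_intro (mem_enum_image.2 ⟨f γ, ?_, hf γ (mem_enum_types.1 hγ)⟩) Cl.head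
          exact (hR _).2 ⟨γ, ⟨mem_enum_types.1 hγ, hγB⟩, rfl⟩
        · refine Cl.negE Cl.head (Cl.hyp (.inr (List.mem_map_of_mem ?_)))
          simp [hγ, hγB]
      · intro α hα
        simp only [List.mem_map, List.mem_filter, decide_eq_true_eq] at hα
        obtain ⟨γ, ⟨hγ, hγB⟩, rfl⟩ := hα
        refine Cl.box_neg (Cl.hyp ((hB (.dia γ) ?_).resolve_left hγB))
        simp [hγ]
    -- The formula at each level contains that of the level below for `t` itself, so all levels are
    -- derived; their modal conjuncts come from level `k` by `hintikka_le`.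
    have hj : ∀ j ≤ k + 1, Cl r ℓ B (hintikka (treeModel X) j t) := by
      intro j
      induction j with
      | zero =>
        refine fun _ => hintikka_zero_intro ?_ ?_ <;> intro p hp
        · exact Cl.hyp ((ht p).1 hp)
        · exact Cl.hyp ((hB (.var p.1) (by simp)).resolve_left (mt (ht p).2 hp))
      | succ j ihj =>
        intro hj
        refine hintikka_succ_intro (ihj (by omega)) (fun v hv => ?_)
          (hbox.boxMon₁ (Cl.self.disj_elim fun γ hγ => ?_))
        · obtain ⟨γ, ⟨hγ, hγB⟩, rfl⟩ := (hR v).1 hv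
          refine (Cl.hyp hγB).diaMon ?_
          rw [← hf γ hγ, hf γ hγ]
          have := hintikka_le (r := r) (ℓ := ℓ) (M := treeModel X) (w := f γ) (j := j) (k := k)
            (by omega)
          rwa [hf γ hγ] at this
        · obtain ⟨v, hv, rfl⟩ := mem_enum_image.1 hγ
          exact Cl.disj_intro (mem_enum_image.2 ⟨v, hv, rfl⟩)
            (Cl.head.trans (hintikka_le (by omega)))
    exact Cl.disj_intro (mem_enum_types.2 ⟨t, rfl⟩) (hj _ le_rfl)

end Types

/-! ### Formulas `⊤ ⊆ α` and `•α` -/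

namespace Prov

variable {P : Type u} {r : Reading} {ℓ : Logic} {Γ : Set (Form P ℓ)} {φ ψ χ : Form P ℓ} {α β : ML P}

/-- Reducing `𝖺 ⊆ 𝖺` gives `¬𝖺^𝗑 ∨ 𝗑 ⊆ 𝖺`. The assumption `𝖺^𝗑` is classical, so `∨E` may keep it to
refute the first disjunct. -/
theorem prim_intro {Γ : Set (Form P .inclusion)} {n : ℕ} {x : Fin (n + 1) → Bool}
    {a : Fin (n + 1) → ML P} (d : Prov r Γ (ML.seqPow a x).toForm) : Prov r Γ (.prim x a) :=
  d.trans <| .orE (inclRdt x (inclId a)) (Δ := {(ML.seqPow a x).toForm}) subset_rfl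
    (by simp [Form.IsClassical]) (negE (.assumption (by simp)) head) head

theorem prim_singleton : Form.prim (n := 0) (fun _ => true) (fun _ => α) = .somewhere .inclusion α :=
  rfl

theorem somewhere_intro (d : Prov r Γ α.toForm) : Prov r Γ (.somewhere ℓ α) := by
  cases ℓ with
  | inclusion =>
    rw [← prim_singleton]
    exact prim_intro (by rwa [ML.seqPow_singleton])
  | might m => exact mightI d

theorem somewhere_negE (d : Prov r Γ (.somewhere ℓ α)) (d' : Prov r Γ (.neg α)) : Prov r Γ φ := by
  cases ℓ with
  | inclusion => exact inclNegE (by rwa [ML.seqPow_singleton]) (prim_singleton (α := α) ▸ d)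
  | might m => exact mightNegE d' d

theorem or_somewhere_elim (d : Prov r Γ (.or (.somewhere ℓ α) ψ))
    (d₀ : Prov r (insert (.somewhere ℓ α) Γ) χ) (d₁ : Prov r (insert ψ Γ) χ) : Prov r Γ χ := by
  cases ℓ with
  | inclusion =>
    rw [← prim_singleton] at d d₀
    exact orInclE d d₀ d₁
  | might m => exact orMightE d d₀ d₁

theorem box_or_somewhere_elim (d : Prov r Γ (.box (.or (.somewhere ℓ α) ψ)))
    (d₀ : Prov r (insert (.somewhere ℓ (.dia α)) Γ) χ) (d₁ : Prov r (insert (.box ψ) Γ) χ) :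
    Prov r Γ χ := by
  cases ℓ with
  | inclusion =>
    rw [← prim_singleton] at d
    exact boxOrInclE d (by rwa [ML.seqPow_singleton]) d₁
  | might m => exact boxOrMightE d d₀ d₁

theorem somewhere_dia (d : Prov r Γ (.dia (.somewhere ℓ α))) : Prov r Γ (.somewhere ℓ (.dia α)) := by
  cases ℓ with
  | inclusion =>
    rw [← prim_singleton] at d
    have := diaInclDistr d
    rwa [ML.seqPow_singleton] at this
  | might m => exact diaMightDistr d

/-- `diaBoxMightExc` is applied to classical formulas only, and likewise `mightDiaDistr` in
`somewhere_dia_distr`; this is why both readings are covered. -/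
theorem box_somewhere (d : Prov r Γ (.somewhere ℓ (.dia α))) : Prov r Γ (.box (.somewhere ℓ α)) := by
  cases ℓ with
  | inclusion =>
    rw [← prim_singleton]
    exact diaBoxInclExc (by rwa [ML.seqPow_singleton])
  | might m => exact diaBoxMightExc (fun _ _ => ⟨α, rfl⟩) d

theorem somewhere_or_distr (L : List (ML P)) (d : Prov r Γ (.or φ ψ))
    (h : ∀ α ∈ L, Prov r Γ (.somewhere ℓ α)) :
    Prov r Γ (.or ((L.map (Form.somewhere ℓ)).foldl .and ((L.map ML.toForm).foldl .or φ)) ψ) := by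
  cases ℓ with
  | inclusion =>
    have := inclDistr (L.map fun α => ⟨0, fun _ => true, fun _ => α⟩) d (List.forall_mem_map.2 h)
    simp only [List.map_map, Function.comp_def, ML.seqPow_singleton] at this
    exact this
  | might m =>
    have := mightDistr (L.map ML.toForm) d (List.forall_mem_map.2 h)
    simp only [List.map_map, Function.comp_def] at this
    exact this

theorem somewhere_dia_distr (L : List (ML P)) (d : Prov r Γ (.dia φ))
    (h : ∀ α ∈ L, Prov r Γ (.somewhere ℓ (.dia α))) :
    Prov r Γ (.dia ((L.map (Form.somewhere ℓ)).foldl .and ((L.map ML.toForm).foldl .or φ))) := by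
  cases ℓ with
  | inclusion =>
    have := inclDiaDistr (L.map fun α => (true, α)) d (List.forall_mem_map.2 h)
    simp only [List.map_map, Function.comp_def] at this
    exact this
  | might m =>
    have := mightDiaDistr (L.map ML.toForm)
      (fun ψ hψ _ _ => by obtain ⟨α, -, rfl⟩ := List.mem_map.1 hψ; exact ⟨α, rfl⟩) d
      (List.forall_mem_map.2 h)
    simp only [List.map_map, Function.comp_def] at this
    exact this

/-- Excluded middle for `α`, with the disjunct `α` replaced by `⊤ ⊆ α` or `•α`: its elimination
keeps all of `Γ`, so `d` remains at hand to refute `¬α`. -/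
theorem somewhere_mono (d : Prov r Γ (.somewhere ℓ β)) (h : Cl r ℓ {β} α) :
    Prov r Γ (.somewhere ℓ α) := by
  have e : Prov r Γ (.or α.toForm (.neg α)) :=
    Prov.weaken (Cl.em (ℓ := ℓ) (A := ∅) (α := α)) (by simp)
  refine or_somewhere_elim (e.or_mono (somewhere_intro self) self) head ?_
  exact somewhere_negE (d.weaken (Set.subset_insert _ _))
    (head.trans (Cl.prov (α := .neg α) (Cl.self.contrapose h)))

end Prov

/-! ### Normal forms -/

section NormalForm

variable {P : Type u} {r : Reading} {ℓ : Logic} {X : Finset P} {k : ℕ} {Γ : Set (Form P ℓ)}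
  {φ ψ χ : Form P ℓ} {α β : ML P} {U U' : List (ML P)}

/-- The Hintikka formula of a team in which exactly the formulas in `U` are realized. -/
def typeTeam (ℓ : Logic) (U : List (ML P)) : Form P ℓ :=
  .and (.disj (U.map ML.toForm)) (.conj (U.map (Form.somewhere ℓ)))

theorem typeTeam_intro (d : Prov r Γ (ML.disj U).toForm)
    (h : ∀ β ∈ U, Prov r Γ (.somewhere ℓ β)) : Prov r Γ (typeTeam ℓ U) :=
  .andI (by rwa [ML.toForm_disj] at d) (Prov.conj_intro (by simpa using h))

theorem typeTeam_disj (d : Prov r Γ (typeTeam ℓ U)) : Prov r Γ (ML.disj U).toForm := by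
  rw [ML.toForm_disj]
  exact d.andE_left

theorem typeTeam_somewhere (d : Prov r Γ (typeTeam ℓ U)) (hβ : β ∈ U) :
    Prov r Γ (.somewhere ℓ β) :=
  d.andE_right.conj_elim _ (List.mem_map_of_mem hβ)

theorem disj_subset (d : Prov r Γ (ML.disj U).toForm) (h : ∀ β ∈ U, β ∈ U') :
    Prov r Γ (ML.disj U').toForm :=
  d.trans (Cl.self.disj_elim fun β hβ => Cl.disj_intro (h β hβ) Cl.head).prov

theorem typeTeam_congr (d : Prov r Γ (typeTeam ℓ U)) (h : ∀ β, β ∈ U ↔ β ∈ U') :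
    Prov r Γ (typeTeam ℓ U') :=
  typeTeam_intro (disj_subset (typeTeam_disj d) fun β => (h β).1)
    fun β hβ => typeTeam_somewhere d ((h β).2 hβ)

theorem typeTeam_singleton (d : Prov r Γ β.toForm) : Prov r Γ (typeTeam ℓ [β]) :=
  typeTeam_intro d (by simpa using Prov.somewhere_intro d)

/-- The left side is the shape produced by the distribution rules; the added disjuncts are already
in `⋁ U`. -/
theorem typeTeam_of_foldl :
    Prov r {(U.map (Form.somewhere ℓ)).foldl .and
      ((U.map ML.toForm).foldl .or (ML.disj U).toForm)} (typeTeam ℓ U) := by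
  obtain ⟨e, e'⟩ := Prov.foldl_and_elim (Prov.self (r := r)
    (φ := (U.map (Form.somewhere ℓ)).foldl .and
      ((U.map ML.toForm).foldl .or (ML.disj U).toForm)))
  refine typeTeam_intro (e.foldl_or_elim .self ?_) fun β hβ => e' _ (List.mem_map_of_mem hβ)
  intro φ hφ
  obtain ⟨β, hβ, rfl⟩ := List.mem_map.1 hφ
  exact (Cl.disj_intro hβ Cl.self).prov

/-- Distributing the realized types of one `U` into its disjunct completes it to a team formula; `ψ`
stores the disjuncts not being treated. -/
theorem typeTeam_flatten_aux (D : List (List (ML P)))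
    (d : Prov r Γ (.or (.disj (D.map fun U => (ML.disj U).toForm)) ψ))
    (h : ∀ U ∈ D, ∀ β ∈ U, Prov r Γ (.somewhere ℓ β)) :
    Prov r Γ (.or (.disj (D.map (typeTeam ℓ))) ψ) := by
  induction D generalizing ψ with
  | nil => exact d
  | cons U D ih =>
    have d₁ : Prov r Γ (.or (ML.disj U).toForm
        (.or (.disj (D.map fun U => (ML.disj U).toForm)) ψ)) :=
      d.or_elim ((Prov.disj_cons .self).or_mono .self (.orI_left .self))
        (.orI_right (.orI_right .self))
    have d₂ : Prov r Γ (.or (typeTeam ℓ U) (.or (.disj (D.map fun U => (ML.disj U).toForm)) ψ)) := by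
      exact (Prov.somewhere_or_distr U d₁ (h U (by simp))).or_mono typeTeam_of_foldl .self
    -- The completed disjunct is parked in `ψ`, so that the induction hypothesis applies to the
    -- rest.
    have d₃ : Prov r Γ (.or (.disj (D.map (typeTeam ℓ))) (.or ψ (typeTeam ℓ U))) :=
      ih (d₂.or_elim (.orI_right (.orI_right .self))
        (Prov.self.or_mono .self (.orI_left .self))) fun U' hU' => h U' (List.mem_cons_of_mem _ hU')
    exact d₃.or_elim (.orI_left (Prov.disj_of_or (.orI_right .self)))
      (Prov.self.or_elim (.orI_right .self)
        (.orI_left (Prov.disj_intro (by simp) .self)))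

/-- The parts of a split team may overlap, so each part can be enlarged to realize every type of its
`U`, all of which occur in the whole team. -/
theorem typeTeam_flatten (D : List (List (ML P))) (d : Prov r Γ (typeTeam ℓ D.flatten)) :
    Prov r Γ (.disj (D.map (typeTeam ℓ))) := by
  refine (typeTeam_flatten_aux D (ψ := .bot) (.orI_left ?_) fun U hU β hβ =>
    typeTeam_somewhere d (List.mem_flatten.2 ⟨U, hU, hβ⟩)).or_elim .self Prov.self.botE
  have : Cl r ℓ {ML.disj D.flatten} (ML.disj (D.map ML.disj)) :=
    Cl.self.disj_elim fun β hβ => by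
      obtain ⟨U, hU, hβ⟩ := List.mem_flatten.1 hβ
      exact Cl.disj_intro (List.mem_map_of_mem hU) (Cl.disj_intro hβ Cl.head)
  have e := (typeTeam_disj d).trans this.prov
  rwa [ML.toForm_disj, List.map_map] at e

/-! ### Case distinctions that keep non-classical assumptions -/

/-- A monotone operator `F` on formulas such that from `F ((⊤ ⊆ β) ∨ ψ)` one may argue by cases
`t β` and `F ψ`. -/
structure Splits (r : Reading) (F : Form P ℓ → Form P ℓ) (t : ML P → Form P ℓ) : Prop where
  mono : ∀ {Γ φ ψ}, Prov r Γ (F φ) → Prov r {φ} ψ → Prov r Γ (F ψ)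
  elim : ∀ {Γ β ψ χ}, Prov r Γ (F (.or (.somewhere ℓ β) ψ)) → Prov r (insert (t β) Γ) χ →
    Prov r (insert (F ψ) Γ) χ → Prov r Γ χ

theorem splits_id : Splits (ℓ := ℓ) (P := P) r id (Form.somewhere ℓ) :=
  ⟨Prov.trans, Prov.or_somewhere_elim⟩

theorem splits_box : Splits (ℓ := ℓ) (P := P) r Form.box fun β => .somewhere ℓ (.dia β) :=
  ⟨fun {_ φ _} d e => .boxMon [φ] (e.weaken (by simp)) (by simpa using d),
    Prov.box_or_somewhere_elim⟩

variable {F : Form P ℓ → Form P ℓ} {t : ML P → Form P ℓ}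

theorem Splits.team (hF : Splits r F t) (L : List (ML P)) (hL : ∀ β ∈ L, β ∈ U)
    (d : Prov r Γ (F (.or (typeTeam ℓ U) ψ)))
    (h₀ : ∀ Γ', Γ ⊆ Γ' → (∀ β ∈ L, Prov r Γ' (t β)) → Prov r Γ' χ)
    (h₁ : ∀ Γ', Γ ⊆ Γ' → Prov r Γ' (F ψ) → Prov r Γ' χ) : Prov r Γ χ := by
  induction L generalizing Γ with
  | nil => exact h₀ Γ subset_rfl (by simp)
  | cons β L ih =>
    have s : ∀ φ, Γ ⊆ insert φ Γ := fun φ => Set.subset_insert _ _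
    refine hF.elim (hF.mono d (Prov.self.or_mono
      (typeTeam_somewhere .self (hL β (by simp))) .self)) ?_ (h₁ _ (s _) .head)
    refine ih (fun β hβ => hL β (List.mem_cons_of_mem _ hβ)) (d.weaken (s _))
      (fun Γ' hΓ' h => h₀ Γ' ((s _).trans hΓ') ?_) fun Γ' hΓ' => h₁ Γ' ((s _).trans hΓ')
    simpa using ⟨.assumption (hΓ' (Set.mem_insert _ _)), h⟩

/-- `D` holds the disjuncts whose types are known to be realized, `C` those still unexamined. Each
member of `C` moves to `D` or disappears from the formula under `F`. -/
theorem Splits.teams (hF : Splits r F t) (C D : List (List (ML P)))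
    (d : Prov r Γ (F (.or (.disj (D.map (typeTeam ℓ))) (.disj (C.map (typeTeam ℓ))))))
    (hD : ∀ U ∈ D, ∀ β ∈ U, Prov r Γ (t β))
    (h : ∀ Γ', Γ ⊆ Γ' → ∀ D', D' ⊆ D ++ C → Prov r Γ' (F (.disj (D'.map (typeTeam ℓ)))) →
      (∀ U ∈ D', ∀ β ∈ U, Prov r Γ' (t β)) → Prov r Γ' χ) : Prov r Γ χ := by
  induction C generalizing Γ D with
  | nil =>
    exact h Γ subset_rfl D (by simp) (hF.mono d (Prov.self.or_elim .self Prov.self.botE)) hD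
  | cons U C ih =>
    refine hF.team (U := U) (ψ := .or (.disj (D.map (typeTeam ℓ))) (.disj (C.map (typeTeam ℓ)))) U
      (fun _ => id) (hF.mono d ?_) (fun Γ' hΓ' hU => ?_) fun Γ' hΓ' d' => ?_
    · exact Prov.self.or_elim (.orI_right (.orI_left .self))
        ((Prov.disj_cons .self).or_mono .self (.orI_right .self))
    · refine ih (U :: D) (hF.mono (d.weaken hΓ') ?_) ?_ fun Γ'' hΓ'' D' hD' =>
        h Γ'' (hΓ'.trans hΓ'') D' fun V hV => ?_
      · exact Prov.self.or_elim (.orI_left (Prov.disj_of_or (.orI_right .self)))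
          ((Prov.disj_cons .self).or_mono (Prov.disj_intro (by simp) .self) .self)
      · intro V hV
        rcases List.mem_cons.1 hV with rfl | hV
        · exact hU
        · exact fun β hβ => (hD V hV β hβ).weaken hΓ'
      · have := hD' hV
        simp only [List.cons_append, List.mem_cons, List.mem_append] at this ⊢
        tauto
    · refine ih D d' (fun V hV β hβ => (hD V hV β hβ).weaken hΓ') fun Γ'' hΓ'' D' hD' =>
        h Γ'' (hΓ'.trans hΓ'') D' fun V hV => ?_
      have := hD' hV
      simp only [List.mem_cons, List.mem_append] at this ⊢
      tauto

/-- `φ` derives all formulas that follow from each of the team formulas over `types X k` that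
derive `φ`. -/
def HasNormalForm (r : Reading) (X : Finset P) (k : ℕ) (φ : Form P ℓ) : Prop :=
  ∀ χ, (∀ U : List (ML P), (∀ β ∈ U, β ∈ types X k) → Prov r {typeTeam ℓ U} φ →
    Prov r {typeTeam ℓ U} χ) → Prov r {φ} χ

/-! ### Closure of normal forms under the connectives -/

namespace HasNormalForm

/-- Up to order and repetition, a list of types is a sublist of `enum (types X k)`, so the
disjunction of the team formulas deriving `φ` is finite and can serve as `χ`. -/
theorem exists_list (h : HasNormalForm r X k φ) : ∃ C : List (List (ML P)),
    (∀ U ∈ C, (∀ β ∈ U, β ∈ types X k) ∧ Prov r {typeTeam ℓ U} φ) ∧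
      Prov r {φ} (.disj (C.map (typeTeam ℓ))) := by
  classical
  refine ⟨(enum (types X k)).sublists.filter fun U => Prov r {typeTeam ℓ U} φ, ?_, h _ ?_⟩
  · intro U hU
    simp only [List.mem_filter, List.mem_sublists, decide_eq_true_eq] at hU
    exact ⟨fun β hβ => mem_enum_types.1 (hU.1.subset hβ), hU.2⟩
  · intro U hU d
    have hmem : ∀ β, β ∈ (enum (types X k)).filter (· ∈ U) ↔ β ∈ U := by
      intro β
      simp only [List.mem_filter, decide_eq_true_eq, mem_enum_types]
      exact ⟨And.right, fun h => ⟨hU β h, h⟩⟩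
    refine Prov.disj_intro (List.mem_map_of_mem (a := (enum (types X k)).filter (· ∈ U)) ?_)
      (typeTeam_congr .self fun β => (hmem β).symm)
    simp only [List.mem_filter, List.mem_sublists, decide_eq_true_eq]
    exact ⟨List.filter_sublist, (typeTeam_congr .self hmem).trans d⟩

/-- `U` is the union of the surviving disjuncts. `F` retains only the classical part `⋁ U`; the
realized types are recorded outside it by `t`. -/
theorem decompose (h : HasNormalForm r X k φ) (hF : Splits r F t) (d : Prov r Γ (F φ))
    (hχ : ∀ Γ', Γ ⊆ Γ' → ∀ U : List (ML P), (∀ β ∈ U, β ∈ types X k) →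
      Prov r {typeTeam ℓ U} φ → Prov r Γ' (F (ML.disj U).toForm) →
      (∀ β ∈ U, Prov r Γ' (t β)) → Prov r Γ' χ) : Prov r Γ χ := by
  obtain ⟨C, hC, e⟩ := h.exists_list
  refine hF.teams C [] (hF.mono d (.orI_right e)) (by simp) fun Γ' hΓ' D hD d' hD' => ?_
  have hD : D ⊆ C := by simpa using hD
  refine hχ Γ' hΓ' D.flatten ?_ ?_ (hF.mono d' ?_) ?_
  · intro β hβ
    obtain ⟨U, hU, hβ⟩ := List.mem_flatten.1 hβ
    exact (hC U (hD hU)).1 β hβ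
  · refine (typeTeam_flatten D .self).disj_elim' fun ψ hψ => ?_
    obtain ⟨U, hU, rfl⟩ := List.mem_map.1 hψ
    exact (hC U (hD hU)).2
  · refine Prov.self.disj_elim' fun ψ hψ => ?_
    obtain ⟨U, hU, rfl⟩ := List.mem_map.1 hψ
    exact disj_subset (typeTeam_disj .self) fun β hβ => List.mem_flatten.2 ⟨U, hU, hβ⟩
  · intro β hβ
    obtain ⟨U, hU, hβ⟩ := List.mem_flatten.1 hβ
    exact hD' U hU β hβ

theorem cases (h : HasNormalForm r X k φ) (d : Prov r Γ φ)
    (hχ : ∀ Γ', Γ ⊆ Γ' → ∀ U : List (ML P), (∀ β ∈ U, β ∈ types X k) →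
      Prov r {typeTeam ℓ U} φ → Prov r Γ' (typeTeam ℓ U) → Prov r Γ' χ) : Prov r Γ χ :=
  h.decompose splits_id d fun Γ' hΓ' U hU e d₀ d₁ => hχ Γ' hΓ' U hU e (typeTeam_intro d₀ d₁)

theorem congr (h : HasNormalForm r X k φ) (e : ProvEquiv r φ ψ) : HasNormalForm r X k ψ :=
  fun χ hχ => e.2.trans (h χ fun U hU d => hχ U hU (d.trans e.1))

/-- One-type teams suffice: each type derives `α` or refutes it, and `α`, being classical, can be
kept in `∨E`. -/
theorem classical (hα : α.Over X k) : HasNormalForm (ℓ := ℓ) r X k α.toForm := by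
  intro χ hχ
  have d := (types_exhaustive (r := r) (ℓ := ℓ) X k (A := {α}))
  rw [Cl, Set.image_singleton, ML.toForm_disj] at d
  refine Prov.disj_elim (Δ := {α.toForm}) subset_rfl (by simp [Form.IsClassical]) d fun ψ hψ => ?_
  obtain ⟨β, hβ, rfl⟩ := List.mem_map.1 hψ
  rw [mem_enum_types] at hβ
  rcases types_decide (r := r) (ℓ := ℓ) hβ hα with h | h
  · refine Prov.head.trans ?_
    have e : Prov r {typeTeam ℓ [β]} β.toForm := typeTeam_disj .self
    exact (typeTeam_singleton .self).trans
      (hχ [β] (by simpa using hβ) (e.trans h.prov))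
  · exact Prov.negE (.assumption (by simp)) (Prov.head.trans h.prov)

theorem or (h : HasNormalForm r X k φ) (h' : HasNormalForm r X k ψ) :
    HasNormalForm r X k (.or φ ψ) := fun _ hχ =>
  Prov.self.or_elim (h _ fun U hU d => hχ U hU d.orI_left)
    (h' _ fun U hU d => hχ U hU d.orI_right)

theorem disj_derives_neg (hU : ∀ β ∈ U, Cl r ℓ {β} (.neg α)) (d : Prov r Γ (typeTeam ℓ U)) :
    Prov r Γ (.neg α) :=
  (typeTeam_disj d).trans
    (Cl.prov (β := .neg α) (Cl.self.disj_elim fun β hβ => Cl.head.trans (hU β hβ)))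

/-- Team formulas with different sets of types are contradictory: a type in only one of them is
realized there and refuted by the other's disjunction. -/
theorem and (h : HasNormalForm r X k φ) (h' : HasNormalForm r X k ψ) :
    HasNormalForm r X k (.and φ ψ) := by
  intro χ hχ
  refine h.cases (Prov.andE_left .self) fun Γ hΓ U hU e d => ?_
  refine h'.cases (Prov.andE_right (.assumption (hΓ rfl))) fun Γ' hΓ' U' hU' e' d' => ?_
  have key : ∀ {V V' : List (ML P)}, (∀ β ∈ V, β ∈ types X k) → (∀ β ∈ V', β ∈ types X k) →
      Prov r Γ' (typeTeam ℓ V) → Prov r Γ' (typeTeam ℓ V') → ∀ {β}, β ∈ V → β ∉ V' → Prov r Γ' χ := by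
    intro V V' hV hV' dV dV' β hβ hβ'
    refine Prov.somewhere_negE (typeTeam_somewhere dV hβ) (disj_derives_neg (fun γ hγ => ?_) dV')
    exact types_incompatible (hV' γ hγ) (hV β hβ) (by rintro rfl; exact hβ' hγ)
  have d := d.weaken hΓ'
  by_cases hUU : ∀ β, β ∈ U ↔ β ∈ U'
  · exact d.trans (hχ U hU (.andI e ((typeTeam_congr .self hUU).trans e')))
  · push Not at hUU
    obtain ⟨β, ⟨h₁, h₂⟩ | ⟨h₁, h₂⟩⟩ := hUU
    · exact key hU hU' d d' h₁ h₂
    · exact key hU' hU d' d h₂ h₁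

theorem list_disj {L : List (Form P ℓ)} (h : ∀ φ ∈ L, HasNormalForm r X k φ) :
    HasNormalForm r X k (.disj L) :=
  bigOp_induction (classical ML.over_bot) (fun _ _ => or) h

theorem list_conj {L : List (Form P ℓ)} (h : ∀ φ ∈ L, HasNormalForm r X k φ) :
    HasNormalForm r X k (.conj L) :=
  bigOp_induction (classical ML.over_top) (fun _ _ => and) h

theorem somewhere (hα : α.Over X k) : HasNormalForm r X k (.somewhere ℓ α) := by
  intro χ hχ
  -- The case distinction for `⊤` fixes the set of types of the team.
  refine (classical (ℓ := ℓ) (r := r) (X := X) (k := k) ML.over_top).cases .top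
    fun Γ hΓ U hU _ d => ?_
  by_cases hU' : ∃ β ∈ U, Cl r ℓ {β} α
  · obtain ⟨β, hβ, h⟩ := hU'
    exact d.trans (hχ U hU ((typeTeam_somewhere .self hβ).somewhere_mono h))
  · push Not at hU'
    exact Prov.somewhere_negE (.assumption (hΓ rfl)) (disj_derives_neg (fun β hβ =>
      (types_decide (hU β hβ) hα).resolve_left (hU' β hβ)) d)

theorem over_disj_types (hU : ∀ β ∈ U, β ∈ types X k) : (ML.disj U).Over X k :=
  ML.over_disj fun β hβ => over_of_mem_types (hU β hβ)

theorem conj_somewhere_dia (hU : ∀ β ∈ U, β ∈ types X k) :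
    HasNormalForm r X (k + 1) (.conj (U.map fun β => Form.somewhere ℓ (.dia β))) :=
  list_conj fun φ hφ => by
    obtain ⟨β, hβ, rfl⟩ := List.mem_map.1 hφ
    exact somewhere (over_of_mem_types (hU β hβ)).dia

/-- The diamond is traded for a classical `◇⋁ U` and the formulas `⊤ ⊆ ◇β` or `•◇β`, which have
normal forms one level up. -/
theorem dia_typeTeam (hU : ∀ β ∈ U, β ∈ types X k) :
    HasNormalForm r X (k + 1) (.dia (typeTeam ℓ U)) := by
  refine ((classical (over_disj_types hU).dia).and (conj_somewhere_dia hU)).congr ⟨?_, ?_⟩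
  · refine .diaMon ?_ (Prov.somewhere_dia_distr U (.andE_left .self) fun β hβ =>
      (Prov.andE_right .self).conj_elim _ (List.mem_map_of_mem hβ))
    exact typeTeam_of_foldl
  · exact .andI (.diaMon (typeTeam_disj .self) .self) (Prov.conj_intro (by
      simpa using fun β hβ => Prov.somewhere_dia (.diaMon (typeTeam_somewhere .self hβ) .self)))

theorem dia (h : HasNormalForm r X k φ) : HasNormalForm r X (k + 1) (.dia φ) := by
  obtain ⟨C, hC, e⟩ := h.exists_list
  have key : ∀ (L : List (Form P ℓ)) {Γ : Set (Form P ℓ)}, Prov r Γ (.dia (.disj L)) →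
      Prov r Γ (.disj (L.map .dia)) := by
    intro L
    induction L with
    | nil =>
      intro Γ d
      exact d.trans (Cl.prov (α := .dia .bot) (β := .bot)
        (Cl.negE Cl.self (Cl.neg_dia (Cl.boxMon [] Cl.top (by simp)))))
    | cons φ L ih =>
      exact fun d => Prov.disj_of_or ((Prov.diaOrDistr (.diaMon (Prov.disj_cons .self) d)).or_mono
        .self (ih .self))
  refine (list_disj (L := (C.map (typeTeam ℓ)).map .dia) ?_).congr
    ⟨Prov.self.disj_elim' ?_, key _ (.diaMon e .self)⟩
  all_goals
    simp only [List.mem_map, exists_exists_and_eq_and]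
    rintro _ ⟨U, hU, rfl⟩
  · exact dia_typeTeam (hC U hU).1
  · exact .diaMon (hC U hU).2 .self

/-- `□` does not distribute over `∨`, so the disjunction is decomposed below `□`. What remains again
consists of a classical formula and formulas `⊤ ⊆ ◇β` or `•◇β`. -/
theorem box (h : HasNormalForm r X k φ) : HasNormalForm r X (k + 1) (.box φ) := by
  intro χ hχ
  refine h.decompose splits_box .self fun Γ _ U hU e d d' => ?_
  have hN := (classical (ℓ := ℓ) (r := r) (over_disj_types hU).box).and (conj_somewhere_dia hU)
  refine Prov.trans (.andI d (Prov.conj_intro (by simpa using d'))) (hN χ fun V hV e' => ?_)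
  refine hχ V hV (e'.trans (.boxMon ((ML.disj U).toForm :: U.map (Form.somewhere ℓ))
    (Prov.trans (typeTeam_intro (.assumption (by simp)) fun β hβ => .assumption ?_) e) ?_))
  · exact List.mem_cons_of_mem _ (List.mem_map_of_mem hβ)
  · simp only [List.mem_cons, List.mem_map]
    rintro _ (rfl | ⟨β, hβ, rfl⟩)
    · exact .andE_left .self
    · exact Prov.box_somewhere ((Prov.andE_right .self).conj_elim _ (List.mem_map_of_mem hβ))

/-- The atom is interderivable with `⊤ ⊆ 𝖺^𝗑`: in each direction one disjunct of `¬𝖺^𝗑 ∨ 𝗑 ⊆ 𝖺` or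
of excluded middle for `𝖺^𝗑` is contradictory. -/
theorem prim {n : ℕ} {x : Fin (n + 1) → Bool} {a : Fin (n + 1) → ML P}
    (ha : ∀ i, (a i).Over X k) : HasNormalForm r X k (.prim x a) := by
  refine (somewhere (ℓ := .inclusion) (ML.over_seqPow (x := x) ha)).congr ⟨?_, ?_⟩
  · have d : Prov r {Form.somewhere .inclusion (ML.seqPow a x)} (.or (.neg (ML.seqPow a x)) (.prim x a)) :=
      .inclRdt x (.inclId a)
    exact .orInclE d.or_comm .head (Prov.somewhere_negE (.assumption (by simp)) .head)
  · have e : Prov r {Form.prim x a} (.or (ML.seqPow a x).toForm (.neg (ML.seqPow a x))) :=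
      Prov.weaken (Cl.em (A := ∅) (α := ML.seqPow a x)) (by simp)
    exact Prov.or_somewhere_elim (e.or_mono (Prov.somewhere_intro .self) .self) .head
      (.inclNegE .head (.assumption (by simp)))

theorem incl {n : ℕ} {a b : Fin (n + 1) → ML P} (ha : ∀ i, (a i).Over X k)
    (hb : ∀ i, (b i).Over X k) : HasNormalForm r X k (.incl a b) := by
  refine (list_conj ?_).congr ⟨.inclExt .self, Prov.conj_intro ?_⟩
  all_goals
    intro φ hφ
    obtain ⟨x, -, rfl⟩ := List.mem_map.1 hφ
  · exact (classical (α := .neg (ML.seqPow a x)) (ML.over_seqPow ha).neg).or (prim hb)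
  · exact .inclRdt x .self

/-! ### The might operators -/

section Might

variable {m : MightKind} {φ ψ : Form P (.might m)} {Γ : Set (Form P (.might m))}

theorem might_mono (d : Prov r Γ (.might φ)) (e : Prov r {φ} ψ) : Prov r Γ (.might ψ) :=
  .mightMon d (Set.empty_subset Γ) (by simp) (e.weaken (by simp))

theorem might_bot (d : Prov r Γ (.might .bot)) : Prov r Γ φ := .mightNegE (α := .bot) .top d

theorem of_might_derives_bot (e : Prov r {φ} .bot) : HasNormalForm r X k (.might φ) :=
  (classical (α := .bot) ML.over_bot).congr ⟨Prov.self.botE, might_bot (might_mono .self e)⟩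

/-- For `▽` and nonempty `U` this amounts to `▽β` for all `β ∈ U`. The singular operator speaks of
single worlds, so it is contradictory unless `U` consists of one type. -/
theorem might_typeTeam (hU : ∀ β ∈ U, β ∈ types X k) :
    HasNormalForm r X k (.might (typeTeam (.might m) U)) := by
  cases m with
  | tri =>
    -- The empty list is separate: its team formula derives `⊥`, whereas the empty conjunction is
    -- `⊤`.
    rcases U with _ | ⟨β, U⟩
    · exact of_might_derives_bot (typeTeam_disj .self)
    refine (list_conj (L := (β :: U).map (Form.somewhere (.might .tri))) ?_).congr ⟨?_, ?_⟩
    · simp only [List.mem_map]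
      rintro _ ⟨γ, hγ, rfl⟩
      exact somewhere (over_of_mem_types (hU γ hγ))
    · have key : ∀ {U : List (ML P)} {Γ}, Prov r Γ (.might (typeTeam (.might .tri) U)) →
          ∀ γ ∈ U, Prov r Γ (.somewhere _ γ) := fun d γ hγ =>
        .triE (might_mono d (typeTeam_somewhere .self hγ))
      have h : ∀ γ ∈ β :: U, Prov r {Form.conj ((β :: U).map (Form.somewhere (.might .tri)))}
          (.somewhere _ γ) := fun γ hγ => Prov.self.conj_elim _ (List.mem_map_of_mem hγ)
      clear hU
      generalize ({Form.conj ((β :: U).map (Form.somewhere (.might .tri)))} :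
        Set (Form P (.might .tri))) = Γ at h ⊢
      have hsing : ∀ γ ∈ β :: U, Prov r Γ (.might (typeTeam (.might .tri) [γ])) := fun γ hγ =>
        might_mono (h γ hγ) (typeTeam_singleton .self)
      clear h
      induction U generalizing β with
      | nil => exact hsing β (by simp)
      | cons γ U ih =>
        -- `triJoin` merges the subteams for `β` and for the other types; its `▽` conjuncts keep all
        -- these types realized.
        refine might_mono (.triJoin (hsing β (by simp))
          (ih γ fun δ hδ => hsing δ (List.mem_cons_of_mem _ hδ))) ?_
        refine typeTeam_intro (Prov.self.andE_left.andE_left.or_elim ?_ ?_) fun δ hδ => ?_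
        · exact disj_subset (typeTeam_disj .self) (by simp)
        · exact disj_subset (typeTeam_disj .self) (by simp +contextual)
        · rcases List.mem_cons.1 hδ with rfl | hδ
          · exact key Prov.self.andE_left.andE_right _ (by simp)
          · exact key Prov.self.andE_right _ hδ
    · refine Prov.conj_intro fun φ hφ => ?_
      obtain ⟨γ, hγ, rfl⟩ := List.mem_map.1 hφ
      exact .triE (might_mono .self (typeTeam_somewhere .self hγ))
  | dot =>
    by_cases h : ∃ β ∈ U, ∀ γ ∈ U, γ = β
    · obtain ⟨β, hβ, h⟩ := h
      have hU' : ∀ γ, γ ∈ [β] ↔ γ ∈ U := fun γ => by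
        rw [List.mem_singleton]
        exact ⟨by rintro rfl; exact hβ, h γ⟩
      refine (somewhere (over_of_mem_types (hU β hβ))).congr
        ⟨might_mono .self (typeTeam_congr (typeTeam_singleton .self) hU'),
        might_mono .self (typeTeam_disj (U := [β]) (typeTeam_congr .self fun γ => (hU' γ).symm))⟩
    · rcases U with _ | ⟨β, U⟩
      · exact of_might_derives_bot (typeTeam_disj .self)
      push Not at h
      obtain ⟨γ, hγ, hne⟩ := h β (by simp)
      refine (classical (α := .bot) ML.over_bot).congr ⟨Prov.self.botE, ?_⟩
      have d : Prov r {Form.might (typeTeam (.might .dot) (β :: U))}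
          (.might (.and (.might β.toForm) (.might γ.toForm))) :=
        might_mono .self (.andI (typeTeam_somewhere .self (by simp)) (typeTeam_somewhere .self hγ))
      -- `dotAndSimpl` strips the operator from `β` but not from `γ`, and `β` refutes `γ`.
      refine might_bot (might_mono (.dotAndSimpl d) (.mightNegE (α := γ) ?_ (.andE_right .self)))
      exact Prov.trans (.andE_left .self) (Cl.prov (β := .neg γ)
        (types_incompatible (hU β (by simp)) (hU γ hγ) hne.symm))

theorem might (h : HasNormalForm r X k φ) : HasNormalForm r X k (.might φ) := by
  obtain ⟨C, hC, e⟩ := h.exists_list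
  have key : ∀ (L : List (Form P (.might m))) {Γ : Set (Form P (.might m))},
      Prov r Γ (.might (.disj L)) → Prov r Γ (.disj (L.map .might)) := by
    intro L
    induction L with
    | nil => exact might_bot
    | cons φ L ih =>
      exact fun d => Prov.disj_of_or
        ((Prov.mightOrDistr (might_mono d (Prov.disj_cons .self))).or_mono .self (ih .self))
  refine (list_disj (L := (C.map (typeTeam (.might m))).map .might) ?_).congr
    ⟨Prov.self.disj_elim' ?_, key _ (might_mono .self e)⟩
  all_goals
    simp only [List.mem_map, exists_exists_and_eq_and]
    rintro _ ⟨U, hU, rfl⟩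
  · exact might_typeTeam (hC U hU).1
  · exact might_mono .self (hC U hU).2

end Might

end HasNormalForm

/-! ### Induction on the formula and passage to teams -/

theorem hasNormalForm (φ : Form P ℓ) : ∀ {k : ℕ}, φ.symbols ⊆ (X : Set P) → φ.md ≤ k →
    HasNormalForm r X k φ := by
  induction φ with
  | var p => exact fun hs hd => .classical (α := .var p) ⟨hs, hd⟩
  | bot => exact fun hs hd => .classical (α := .bot) ⟨hs, hd⟩
  | neg α => exact fun hs hd => .classical (α := .neg α) ⟨hs, hd⟩
  | or φ ψ ih ih' =>
    exact fun hs hd => (ih (Set.subset_union_left.trans hs) ((le_max_left _ _).trans hd)).or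
      (ih' (Set.subset_union_right.trans hs) ((le_max_right _ _).trans hd))
  | and φ ψ ih ih' =>
    exact fun hs hd => (ih (Set.subset_union_left.trans hs) ((le_max_left _ _).trans hd)).and
      (ih' (Set.subset_union_right.trans hs) ((le_max_right _ _).trans hd))
  | dia φ ih =>
    rintro (_ | k) hs hd
    · simp [Form.md] at hd
    · exact (ih hs (Nat.succ_le_succ_iff.1 hd)).dia
  | box φ ih =>
    rintro (_ | k) hs hd
    · simp [Form.md] at hd
    · exact (ih hs (Nat.succ_le_succ_iff.1 hd)).box
  | incl a b =>
    intro k hs hd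
    simp only [Form.symbols, Set.iUnion_subset_iff, Set.union_subset_iff] at hs
    simp only [Form.md, Finset.sup_le_iff, Finset.mem_univ, true_implies, max_le_iff] at hd
    exact .incl (fun i => ⟨(hs i).1, (hd i).1⟩) fun i => ⟨(hs i).2, (hd i).2⟩
  | might φ ih => exact fun hs hd => (ih hs hd).might

theorem HasNormalForm.exists_teams (h : HasNormalForm r X k φ) :
    ∃ C : Finset (TeamModel X), C.Nonempty ∧
      ProvEquiv r φ (.disj (C.toList.map (teamHintikka ℓ k))) := by
  classical
  obtain ⟨C, hC, e⟩ := h.exists_list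
  let f : List (ML P) → TeamModel X := fun U => ⟨treeModel X, {w | hintikka (treeModel X) k w ∈ U}⟩
  have hf : ∀ U : List (ML P), (∀ β ∈ U, β ∈ types X k) →
      ∀ β, β ∈ U ↔ β ∈ enum (hintikka (f U).M k '' (f U).T) := by
    intro U hU β
    rw [mem_enum_image]
    constructor
    · intro hβ
      obtain ⟨w, rfl⟩ := hU β hβ
      exact ⟨w, hβ, rfl⟩
    · rintro ⟨w, hw, rfl⟩
      exact hw
  -- The empty list is added only to make the set nonempty; its team formula derives `⊥`.
  refine ⟨(([] :: C).map f).toFinset, ⟨f [], by simp⟩, e.disj_mono ?_, Prov.self.disj_elim' ?_⟩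
  · intro ψ hψ
    obtain ⟨U, hU, rfl⟩ := List.mem_map.1 hψ
    refine ⟨teamHintikka ℓ k (f U), List.mem_map_of_mem ?_,
      typeTeam_congr .self (hf U (hC U hU).1)⟩
    simp only [Finset.mem_toList, List.mem_toFinset]
    exact List.mem_map_of_mem (List.mem_cons_of_mem _ hU)
  · intro ψ hψ
    simp only [List.mem_map, Finset.mem_toList, List.mem_toFinset] at hψ
    obtain ⟨_, ⟨U, hU, rfl⟩, rfl⟩ := hψ
    have d : (∀ β ∈ U, β ∈ types X k) → Prov r {teamHintikka ℓ k (f U)} (typeTeam ℓ U) :=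
      fun h => typeTeam_congr .self fun β => (hf U h β).symm
    rcases List.mem_cons.1 hU with rfl | hU
    · exact (typeTeam_disj (d (by simp))).botE
    · exact (d (hC U hU).1).trans (hC U hU).2

end NormalForm

end TeamModal

theorem mainTheorem3 {P : Type*} (r : TeamModal.Reading) (ℓ : TeamModal.Logic) (φ : TeamModal.Form P ℓ)
    (X : Finset P) (hX : φ.symbols ⊆ (X : Set P)) (k : ℕ) (hk : φ.md ≤ k) :
    ∃ C : Finset (TeamModal.TeamModel X), C.Nonempty ∧
      TeamModal.ProvEquiv r φ
        (TeamModal.Form.disj (C.toList.map (TeamModal.teamHintikka ℓ k))) :=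
  (TeamModal.hasNormalForm φ hX hk).exists_teams
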